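/- Let $k$ be a field and let $X$ be a reduced proper curve over $k$ with two irreducible components $Y$ and $Z$, both smooth over $k$, which meet transversally at a single $k$-rational point $N$ (that is, the scheme-theoretic intersection $Y\cap Z$ is the reduced point $N$). For a line bundle $\mathcal L$ on $X$ and $i\in\mathbb Z$, let $\mathcal L^i$ be the line bundle on $X$ with $\mathcal L^i|_Y\cong\mathcal L|_Y(-iN)$ and $\mathcal L^i|_Z\cong\mathcal L|_Z(iN)$, where $\mathcal L^0=\mathcal L$, and let $\varphi^i\colon\mathcal L^i\to\mathcal L^{i+1}$ and $\varphi_i\colon\mathcal L^{i+1}\to\mathcal L^i$ be the compositions \[ \mathcal L^i\to\mathcal L^i|_Z\cong\mathcal L^{i+1}|_Z(-N)\to\mathcal L^{i+1},\qquad \mathcal L^{i+1}\to\mathcal L^{i+1}|_Y\cong\mathcal L^{i}|_Y(-N)\to\mathcal L^{i} \] of natural surjections, isomorphisms and natural injections. Write $\mathcal L_{\mathcal Z}=(\mathcal L^i,\varphi^i,\varphi_i)_{i\in\mathbb Z}$, and let $H^0(\mathcal L_{\mathcal Z})$ be the family of $k$-vector spaces $H^0(X,\mathcal L^i)$ with the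 maps induced by the $\varphi^i$ and $\varphi_i$. A pure subrepresentation of dimension $r$ of $H^0(\mathcal L_{\mathcal Z})$ is a family of subspaces $V_i\subseteq H^0(X,\mathcal L^i)$, $i\in\mathbb Z$, all of dimension $r$, with $\varphi^i(V_i)\subseteq V_{i+1}$ and $\varphi_i(V_{i+1})\subseteq V_i$ for all $i$. Let $\mathfrak h^0(\mathcal L)$ be the maximum dimension of a pure subrepresentation of $H^0(\mathcal L_{\mathcal Z})$. Then for every line bundle $\mathcal L$ on $X$ and every $k$-rational point $P$ of $X$ with $P\neq N$, the maxima $\mathfrak h^0(\mathcal L)$ and $\mathfrak h^0(\mathcal L(-P))$ exist (for any choice of the isomorphisms above), and \[ \mathfrak h^0(\mathcal L)-1\le\mathfrak h^0(\mathcal L(-P))\le\mathfrak h^0(\mathcal L). \] -/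

import Mathlib

open CategoryTheory AlgebraicGeometry

universe u

/-- A representation over `k` of the quiver with vertex set `ℤ` and, for every `i`, one arrow
`i → i + 1` and one arrow `i + 1 → i`. -/
structure ZRep (k : Type u) [Field k] where
  /-- The vector space at the vertex `i`. -/
  V : ℤ → Type u
  [addCommGroup : ∀ i, AddCommGroup (V i)]
  [module : ∀ i, Module k (V i)]
  /-- The map of the arrow `i → i + 1`. -/
  up : ∀ i, V i →ₗ[k] V (i + 1)
  /-- The map of the arrow `i + 1 → i`. -/
  down : ∀ i, V (i + 1) →ₗ[k] V i

namespace ZRep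

attribute [instance] ZRep.addCommGroup ZRep.module

variable {k : Type u} [Field k]

/-- A subrepresentation: a family of subspaces preserved by all the maps. -/
structure Subrep (R : ZRep k) where
  /-- The subspace at the vertex `i`. -/
  W : ∀ i, Submodule k (R.V i)
  up_mem : ∀ i, ∀ w ∈ W i, R.up i w ∈ W (i + 1)
  down_mem : ∀ i, ∀ w ∈ W (i + 1), R.down i w ∈ W i

/-- A subrepresentation has pure dimension `r` if each of its spaces is finite-dimensional of
dimension `r`. -/
def Subrep.IsPure {R : ZRep k} (S : R.Subrep) (r : ℕ) : Prop :=
  ∀ i, Module.Finite k (S.W i) ∧ Module.finrank k (S.W i) = r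

/-- The set of dimensions of the pure subrepresentations. -/
def pureDims (R : ZRep k) : Set ℕ := {r | ∃ S : R.Subrep, S.IsPure r}

end ZRep

namespace AlgebraicGeometry.Scheme.Modules

variable {X : Scheme.{u}}

/-- A sheaf of modules is a line bundle if it is locally free of rank one: every point has an open
neighbourhood `U` and a section `e` over `U` which freely generates the sheaf over `U`. -/
def IsLineBundle (M : X.Modules) : Prop :=
  ∀ x : X, ∃ U : X.Opens, x ∈ U ∧ ∃ e : Γ(M, U), ∀ (V : X.Opens) (h : V ≤ U),
    Function.Bijective fun a : Γ(X, V) ↦ a • (M.presheaf.map (homOfLE h).op e : Γ(M, V))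

/-- The sections over the affine open `U` of the subsheaf `I · M` of `M`, for a quasi-coherent
sheaf of ideals `I` (and a quasi-coherent `M`, such as a line bundle). If `I` is the ideal sheaf of
a closed subscheme `T`, then `M / I · M` is the restriction `M|_T`. -/
noncomputable def idealMul (I : X.IdealSheafData) (M : X.Modules) (U : X.affineOpens) :
    Submodule Γ(X, U.1) Γ(M, U.1) :=
  I.ideal U • ⊤

/-- The kernel of `φ : M ⟶ M'` is the subsheaf `I · M` of `M`. -/
def KernelIs {M M' : X.Modules} (φ : M ⟶ M') (I : X.IdealSheafData) : Prop :=
  ∀ (U : X.affineOpens) (s : Γ(M, U.1)), φ.app U.1 s = 0 ↔ s ∈ idealMul I M U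

/-- The image of `φ : M ⟶ M'` is the subsheaf `I · M'` of `M'`. -/
def ImageIs {M M' : X.Modules} (φ : M ⟶ M') (I : X.IdealSheafData) : Prop :=
  ∀ (U : X.affineOpens) (t : Γ(M', U.1)), (∃ s, φ.app U.1 s = t) ↔ t ∈ idealMul I M' U

end AlgebraicGeometry.Scheme.Modules

open AlgebraicGeometry.Scheme.Modules

/-- A (reduced, proper) curve `X` over a field `k` with two irreducible components `Y` and `Z`,
which are smooth curves meeting transversally at a single `k`-rational point `N`: the
scheme-theoretic intersection of `Y` and `Z` is the reduced point `N`. -/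
structure TwoComponentCurve (k : Type u) [Field k] where
  X : Scheme.{u}
  Y : Scheme.{u}
  Z : Scheme.{u}
  /-- The structure morphism. -/
  f : X ⟶ Spec (.of k)
  iY : Y ⟶ X
  iZ : Z ⟶ X
  isProper : IsProper f
  isReduced : IsReduced X
  isClosedImmersionY : IsClosedImmersion iY
  isClosedImmersionZ : IsClosedImmersion iZ
  isIntegralY : IsIntegral Y
  isIntegralZ : IsIntegral Z
  smoothY : Smooth (iY ≫ f)
  smoothZ : Smooth (iZ ≫ f)
  dimY : topologicalKrullDim Y = 1
  dimZ : topologicalKrullDim Z = 1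
  /-- `X` is the union of `Y` and `Z`. -/
  cover : Set.range iY ∪ Set.range iZ = Set.univ
  /-- The point `N`, as a point of `Y` and as a point of `Z`. -/
  nY : Spec (.of k) ⟶ Y
  nZ : Spec (.of k) ⟶ Z
  nY_section : nY ≫ iY ≫ f = 𝟙 _
  isPullback : IsPullback nY nZ iY iZ

namespace TwoComponentCurve

variable {k : Type u} [Field k] (C : TwoComponentCurve k)

/-- The point `N` where the two components meet, as a `k`-rational point of `X`. -/
noncomputable def N : Spec (.of k) ⟶ C.X := C.nY ≫ C.iY

/-- The ideal sheaf of the component `Y`. -/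
noncomputable def idealY : C.X.IdealSheafData := Scheme.Hom.ker C.iY

/-- The ideal sheaf of the component `Z`. -/
noncomputable def idealZ : C.X.IdealSheafData := Scheme.Hom.ker C.iZ

/-- The homomorphism `k → Γ(X, 𝒪_X)`. -/
noncomputable def scalars : k →+* Γ(C.X, ⊤) :=
  C.f.appTop.hom.comp (Scheme.ΓSpecIso (.of k)).inv.hom

/-- The space of global sections `H⁰(X, M)`. -/
def H0 (M : C.X.Modules) : Type u := Γ(M, ⊤)

noncomputable instance (M : C.X.Modules) : AddCommGroup (C.H0 M) :=
  inferInstanceAs (AddCommGroup Γ(M, ⊤))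

noncomputable instance (M : C.X.Modules) : Module Γ(C.X, ⊤) (C.H0 M) :=
  inferInstanceAs (Module Γ(C.X, ⊤) Γ(M, ⊤))

/-- `H⁰(X, M)` as a vector space over `k`. -/
noncomputable instance (M : C.X.Modules) : Module k (C.H0 M) :=
  Module.compHom (C.H0 M) C.scalars

/-- The `k`-linear map induced on global sections by a morphism of sheaves of modules. -/
noncomputable def H0map {M M' : C.X.Modules} (φ : M ⟶ M') : C.H0 M →ₗ[k] C.H0 M' where
  toFun s := φ.app ⊤ s
  map_add' s t := map_add (φ.app ⊤).hom s t
  map_smul' c s := Scheme.Modules.Hom.app_smul φ (C.scalars c) s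

/-- The linked chain `L_𝒵 = (Lⁱ, φⁱ, φᵢ)` of line bundles of a line bundle `L`, with `L⁰ = L`,
`Lⁱ|_Y = L|_Y(-iN)` and `Lⁱ|_Z = L|_Z(iN)`.

Since the scheme-theoretic intersection of `Y` and `Z` is `N`, and since `I_Y ∩ I_Z = 0`, the
subsheaf `I_Y · M` of a line bundle `M` is `M|_Z(-N)`, and `I_Z · M` is `M|_Y(-N)`.
Hence the kernel and the image of `φⁱ = up i` prescribed below say that `φⁱ` is a composition
`Lⁱ → Lⁱ|_Z ≅ Lⁱ⁺¹|_Z(-N) → Lⁱ⁺¹` of the natural surjection, an isomorphism and the natural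
injection; those of `φᵢ = down i` say that `φᵢ` is such a composition
`Lⁱ⁺¹ → Lⁱ⁺¹|_Y ≅ Lⁱ|_Y(-N) → Lⁱ`. The two isomorphisms say that `Lⁱ|_Z` and `Lⁱ|_Y` are the
twists above. -/
structure TwistChain (L : C.X.Modules) where
  obj : ℤ → C.X.Modules
  isLineBundle : ∀ i, IsLineBundle (obj i)
  /-- `L⁰` is `L`. -/
  zeroIso : obj 0 ≅ L
  up : ∀ i, obj i ⟶ obj (i + 1)
  down : ∀ i, obj (i + 1) ⟶ obj i
  kernel_up : ∀ i, KernelIs (up i) C.idealZ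
  image_up : ∀ i, ImageIs (up i) C.idealY
  kernel_down : ∀ i, KernelIs (down i) C.idealY
  image_down : ∀ i, ImageIs (down i) C.idealZ

namespace TwistChain

variable {C} {L : C.X.Modules} (T : C.TwistChain L)

/-- The representation `H⁰(L_𝒵)`. -/
noncomputable def rep : ZRep k where
  V i := C.H0 (T.obj i)
  up i := C.H0map (T.up i)
  down i := C.H0map (T.down i)

/-- `𝔥⁰(L)`: the maximum dimension of a pure subrepresentation of `H⁰(L_𝒵)`. -/
noncomputable def h0 : ℕ := sSup T.rep.pureDims

end TwistChain

/-- The morphism `ι : L' ⟶ L` exhibits `L'` as `L(-P)`, for a `k`-rational point `P` of `X`: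
it is an isomorphism onto the subsheaf of `L` of sections vanishing at `P`. -/
structure IsTwistByPoint (P : Spec (.of k) ⟶ C.X) {L' L : C.X.Modules} (ι : L' ⟶ L) : Prop where
  mono : Mono ι
  image : ImageIs ι (Scheme.Hom.ker P)

end TwoComponentCurve

/-! The inclusion `L(-P) → L` is injective and invertible away from `P`, and any two sections of `L`
have a nontrivial constant combination in its image. It extends to maps `ιᵢ : L(-P)ⁱ → Lⁱ` with the
same properties, commuting with all `φⁱ` and `φᵢ` up to nonzero constants
(`IsModification.exists_lift`, `TwistChain.exists_modifications`). Indeed `ιᵢ` and a constant `c`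
determine `ιᵢ₊₁`: compatibility with `φᵢ` fixes it modulo sections killed by `φᵢ`, compatibility
with `φⁱ` fixes it off `Y`, and since `X` is reduced these two conditions leave no freedom. The only
obstruction to existence is at `N`, where the two prescriptions must agree. They differ by a nonzero
element of the residue field `k`, which the constant `c` in the relation with `φⁱ` absorbs.

On global sections the `ιᵢ` embed one representation into the other up to constants, so pure
subrepresentations push forward; this is the upper bound. For the lower bound, let `Kᵢ` be the image
of `ιᵢ` on global sections. As `P ≠ N`, the point `P` misses one component, say `Z`. Then `φᵢ` is
invertible near `P`, so `x ∈ Kᵢ₊₁` exactly when `φᵢ(x) ∈ Kᵢ`, and `φᵢ ∘ φⁱ = 0` forces the image of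
`φⁱ` into `Kᵢ₊₁`. For a pure subrepresentation `S`, the indices with `Sᵢ ⊆ Kᵢ` are therefore closed
under `i ↦ i + 1`. Where the inclusion fails, `Sᵢ ∩ Kᵢ` is a hyperplane of `Sᵢ`; beyond the last
failure hyperplanes are chosen inductively (`exists_pure_of_codim_le_one`). If `P` misses `Y`, the
mirror argument applies.

The maxima exist because `H⁰` is finite-dimensional (`finite_H0`), which is proved by viewing
sections as rational functions on each component. -/

namespace AlgebraicGeometry.Scheme

/-! ### Sections, gluing and local generators of sheaves of modules. -/

/-- Restriction of functions to a smaller open. -/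
noncomputable def fres (X : Scheme.{u}) {U V : X.Opens} (h : V ≤ U) : Γ(X, U) →+* Γ(X, V) :=
  (X.presheaf.map (homOfLE h).op).hom

@[simp]
lemma fres_self {X : Scheme.{u}} {U : X.Opens} (h : U ≤ U) (a : Γ(X, U)) : X.fres h a = a := by
  simp [fres]

@[simp]
lemma fres_fres {X : Scheme.{u}} {U V W : X.Opens} (h : V ≤ U) (h' : W ≤ V) (a : Γ(X, U)) :
    X.fres h' (X.fres h a) = X.fres (h'.trans h) a := by
  simp only [fres, ← CommRingCat.comp_apply, ← Functor.map_comp, ← op_comp]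
  rfl

lemma isUnit_fres_of_le_basicOpen {X : Scheme.{u}} {U V : X.Opens} (h : V ≤ U) (a : Γ(X, U))
    (hV : V ≤ X.basicOpen a) : IsUnit (X.fres h a) := by
  have := (RingedSpace.isUnit_res_basicOpen X.toRingedSpace a).map (X.fres hV)
  have h2 := fres_fres (X.basicOpen_le a) hV a
  exact h2 ▸ this

namespace Modules

variable {X : Scheme.{u}}

/-- Restriction of sections to a smaller open. -/
noncomputable def res (M : X.Modules) {U V : X.Opens} (h : V ≤ U) : Γ(M, U) →+ Γ(M, V) :=
  (M.presheaf.map (homOfLE h).op).hom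

@[simp]
lemma res_self (M : X.Modules) {U : X.Opens} (h : U ≤ U) (s : Γ(M, U)) : M.res h s = s := by
  simp [res]

@[simp]
lemma res_res (M : X.Modules) {U V W : X.Opens} (h : V ≤ U) (h' : W ≤ V) (s : Γ(M, U)) :
    M.res h' (M.res h s) = M.res (h'.trans h) s :=
  (ConcreteCategory.congr_hom (M.presheaf.map_comp (homOfLE h).op (homOfLE h').op) s).symm

@[simp]
lemma res_smul (M : X.Modules) {U V : X.Opens} (h : V ≤ U) (a : Γ(X, U)) (s : Γ(M, U)) :
    M.res h (a • s) = X.fres h a • M.res h s :=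
  Modules.map_smul M (homOfLE h) a s

lemma res_app {M M' : X.Modules} (φ : M ⟶ M') {U V : X.Opens} (h : V ≤ U) (s : Γ(M, U)) :
    M'.res h (φ.app U s) = φ.app V (M.res h s) :=
  (NatTrans.naturality_apply φ.mapPresheaf (homOfLE h).op s).symm

lemma eq_of_locally_eq {M : X.Modules} {U : X.Opens} {s t : Γ(M, U)}
    (H : ∀ x ∈ U, ∃ (V : X.Opens) (h : V ≤ U), x ∈ V ∧ M.res h s = M.res h t) : s = t := by
  choose! V hV hx hst using H
  refine TopCat.Sheaf.eq_of_locally_eq' ⟨M.presheaf, M.isSheaf⟩ (fun x : U ↦ V x.1) U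
    (fun x ↦ homOfLE (hV x.1 x.2)) ?_ s t (fun x ↦ hst x.1 x.2)
  intro x hxU
  exact TopologicalSpace.Opens.mem_iSup.mpr ⟨⟨x, hxU⟩, hx x hxU⟩

lemma eq_zero_of_locally {M : X.Modules} {U : X.Opens} {s : Γ(M, U)}
    (H : ∀ x ∈ U, ∃ (V : X.Opens) (h : V ≤ U), x ∈ V ∧ M.res h s = 0) : s = 0 :=
  eq_of_locally_eq (by simpa using H)

/-- Sections which are locally characterized uniquely by a restriction-stable property glue. -/
lemma exists_glue {M : X.Modules} {U : X.Opens} (p : ∀ V : X.Opens, V ≤ U → Γ(M, V) → Prop)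
    (hres : ∀ (V W : X.Opens) (hV : V ≤ U) (h : W ≤ V) (t : Γ(M, V)),
      p V hV t → p W (h.trans hV) (M.res h t))
    (huniq : ∀ (V : X.Opens) (hV : V ≤ U) (t t' : Γ(M, V)), p V hV t → p V hV t' → t = t')
    (hex : ∀ x ∈ U, ∃ (V : X.Opens) (hV : V ≤ U), x ∈ V ∧ ∃ t, p V hV t) :
    ∃ t : Γ(M, U), ∀ x ∈ U, ∃ (V : X.Opens) (hV : V ≤ U), x ∈ V ∧ p V hV (M.res hV t) := by
  choose! V hV hx t ht using hex
  obtain ⟨s, hs, -⟩ := TopCat.Sheaf.existsUnique_gluing' ⟨M.presheaf, M.isSheaf⟩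
    (fun x : U ↦ V x.1) U (fun x ↦ homOfLE (hV x.1 x.2))
    (fun x hxU ↦ TopologicalSpace.Opens.mem_iSup.mpr ⟨⟨x, hxU⟩, hx x hxU⟩)
    (fun x ↦ t x.1) (fun x y ↦ huniq _ (inf_le_left.trans (hV x.1 x.2)) _ _
      (hres _ _ _ inf_le_left _ (ht x.1 x.2)) (hres _ _ _ inf_le_right _ (ht y.1 y.2)))
  refine ⟨s, fun x hxU ↦ ⟨V x, hV x hxU, hx x hxU, ?_⟩⟩
  have : M.res (hV x hxU) s = t x := hs ⟨x, hxU⟩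
  exact this ▸ ht x hxU

/-- A morphism of sheaves of modules from a compatible family of linear maps on sections. -/
noncomputable def homOfSections {M M' : X.Modules} (φ : ∀ U, Γ(M, U) → Γ(M', U))
    (hadd : ∀ U s t, φ U (s + t) = φ U s + φ U t)
    (hsmul : ∀ U (a : Γ(X, U)) s, φ U (a • s) = a • φ U s)
    (hres : ∀ (U V : X.Opens) (h : V ≤ U) s, M'.res h (φ U s) = φ V (M.res h s)) : M ⟶ M' :=
  fullyFaithfulToPresheafOfModules.preimage (PresheafOfModules.homMk
    (M₁ := (toPresheafOfModules X).obj M) (M₂ := (toPresheafOfModules X).obj M')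
    { app := fun U ↦ AddCommGrpCat.ofHom (AddMonoidHom.mk' (φ U.unop) (hadd U.unop))
      naturality := fun U V h ↦ by
        ext s
        exact (hres U.unop V.unop h.unop.le s).symm }
    (fun U r m ↦ hsmul U.unop r m))

lemma app_injective_of_mono {M M' : X.Modules} (φ : M ⟶ M') [Mono φ] (U : X.Opens) :
    Function.Injective (φ.app U) := by
  have h1 : Mono ((toPresheaf X).map φ) := inferInstance
  have h2 : Mono (((toPresheaf X).map φ).app (.op U)) := inferInstance
  exact (AddCommGrpCat.mono_iff_injective _).mp h2

/-- The section `e` freely generates `M` over `U`. -/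
def IsGenerator (M : X.Modules) {U : X.Opens} (e : Γ(M, U)) : Prop :=
  ∀ (V : X.Opens) (h : V ≤ U), Function.Bijective fun a : Γ(X, V) ↦ a • M.res h e

lemma IsGenerator.res {M : X.Modules} {U V : X.Opens} {e : Γ(M, U)} (he : M.IsGenerator e)
    (h : V ≤ U) : M.IsGenerator (M.res h e) := fun W hW ↦ by
  simpa using he W (hW.trans h)

lemma IsGenerator.bijective {M : X.Modules} {U : X.Opens} {e : Γ(M, U)} (he : M.IsGenerator e) :
    Function.Bijective fun a : Γ(X, U) ↦ a • e := by
  simpa using he U le_rfl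

lemma IsLineBundle.exists_generator {M : X.Modules} (hM : M.IsLineBundle) {U : X.Opens} {x : X}
    (hx : x ∈ U) : ∃ (V : X.affineOpens), x ∈ V.1 ∧ V.1 ≤ U ∧ ∃ e : Γ(M, V.1), M.IsGenerator e := by
  obtain ⟨W, hxW, e, he⟩ := hM x
  obtain ⟨_, ⟨V, hV, rfl⟩, hxV, hVW⟩ :=
    X.isBasis_affineOpens.exists_subset_of_mem_open (show x ∈ W ⊓ U from ⟨hxW, hx⟩) (W ⊓ U).isOpen
  have hVW : V ≤ W ⊓ U := hVW
  exact ⟨⟨V, hV⟩, hxV, hVW.trans inf_le_right, M.res (hVW.trans inf_le_left) e,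
    IsGenerator.res he _⟩

lemma IsGenerator.mem_idealMul_iff {M : X.Modules} {U : X.affineOpens} {e : Γ(M, U.1)}
    (he : M.IsGenerator e) (I : X.IdealSheafData) (a : Γ(X, U.1)) :
    a • e ∈ idealMul I M U ↔ a ∈ I.ideal U := by
  constructor
  · intro h
    suffices ∀ s ∈ idealMul I M U, ∃ b ∈ I.ideal U, b • e = s by
      obtain ⟨b, hb, hbe⟩ := this _ h
      rwa [← he.bijective.1 hbe]
    intro s hs
    refine Submodule.smul_induction_on hs ?_ ?_
    · rintro r hr t -
      obtain ⟨b, rfl⟩ := he.bijective.2 t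
      exact ⟨r * b, Ideal.mul_mem_right _ _ hr, mul_smul _ _ _⟩
    · rintro _ _ ⟨b, hb, rfl⟩ ⟨c, hc, rfl⟩
      exact ⟨b + c, add_mem hb hc, add_smul _ _ _⟩
  · exact fun h ↦ Submodule.smul_mem_smul h trivial

lemma app_surjective_of_locally {M M' : X.Modules} (φ : M ⟶ M')
    (hφ : ∀ U, Function.Injective (φ.app U)) {U : X.Opens} (t : Γ(M', U))
    (H : ∀ x ∈ U, ∃ (V : X.Opens) (h : V ≤ U), x ∈ V ∧ ∃ s, φ.app V s = M'.res h t) :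
    ∃ s, φ.app U s = t := by
  obtain ⟨s, hs⟩ := exists_glue (M := M) (U := U) (fun V hV s ↦ φ.app V s = M'.res hV t)
    (fun V W hV h s hs ↦ by rw [← res_app, hs, res_res])
    (fun V hV s s' hs hs' ↦ hφ V (hs.trans hs'.symm)) H
  refine ⟨s, eq_of_locally_eq fun x hx ↦ ?_⟩
  obtain ⟨V, hV, hxV, h⟩ := hs x hx
  exact ⟨V, hV, hxV, by rw [res_app, h]⟩

end Modules

end AlgebraicGeometry.Scheme

/-! ### Pairs of ideal sheaves meeting in a node. -/

namespace AlgebraicGeometry.Scheme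

variable {X : Scheme.{u}}

/-- The ideal sheaves `I` and `J` of two closed subschemes covering the reduced scheme `X`, which
meet in at most one point, where the residue field consists of the values of the constants. -/
structure IsNodal {k : Type*} [Field k] (σ : k →+* Γ(X, ⊤)) (I J : X.IdealSheafData) : Prop where
  inf_eq_bot : I ⊓ J = ⊥
  subsingleton : ∀ x y, x ∈ I.support → x ∈ J.support → y ∈ I.support → y ∈ J.support → x = y
  exists_const : ∀ (U : X.affineOpens) (x : X), x ∈ U.1 → x ∈ I.support → x ∈ J.support →
    ∀ a : Γ(X, U.1), x ∈ X.basicOpen a →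
      ∃ c : k, c ≠ 0 ∧ a - X.fres le_top (σ c) ∈ I.ideal U ⊔ J.ideal U

lemma IsNodal.symm {k : Type*} [Field k] {σ : k →+* Γ(X, ⊤)} {I J : X.IdealSheafData}
    (h : IsNodal σ I J) : IsNodal σ J I where
  inf_eq_bot := inf_comm I J ▸ h.inf_eq_bot
  subsingleton x y hx hx' hy hy' := h.subsingleton x y hx' hx hy' hy
  exists_const U x hx hI hJ a ha := by
    rw [sup_comm]
    exact h.exists_const U x hx hJ hI a ha

lemma ideal_eq_top_of_disjoint_support (J : X.IdealSheafData) (U : X.affineOpens)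
    (hU : ∀ x ∈ U.1, x ∉ J.support) : J.ideal U = ⊤ := by
  have h := U.2.self_le_iSup_basicOpen_iff (s := (J.ideal U : Set Γ(X, U.1)))
  rw [Ideal.span_eq] at h
  rw [← h]
  intro x hx
  have := hU x hx
  rw [IdealSheafData.mem_support_iff_of_mem hx, Scheme.mem_zeroLocus_iff] at this
  push Not at this
  obtain ⟨a, ha, hxa⟩ := this
  exact TopologicalSpace.Opens.mem_iSup.mpr ⟨⟨a, ha⟩, hxa⟩

lemma notMem_basicOpen_of_mem_ideal {J : X.IdealSheafData} {U : X.affineOpens} {x : X}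
    (hx : x ∈ U.1) (hxJ : x ∈ J.support) {a : Γ(X, U.1)} (ha : a ∈ J.ideal U) :
    x ∉ X.basicOpen a := by
  rw [IdealSheafData.mem_support_iff_of_mem hx, Scheme.mem_zeroLocus_iff] at hxJ
  exact hxJ a ha

lemma evaluation_eq_zero_of_mem_ideal {J : X.IdealSheafData} {U : X.affineOpens} {x : X}
    (hx : x ∈ U.1) (hxJ : x ∈ J.support) {a : Γ(X, U.1)} (ha : a ∈ J.ideal U) :
    X.evaluation U.1 x hx a = 0 :=
  (X.evaluation_eq_zero_iff_notMem_basicOpen x hx a).mpr (notMem_basicOpen_of_mem_ideal hx hxJ ha)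

/-- Off the support of `J` the ideal `J` is the unit ideal, so `I = I ⊓ J = 0` there. -/
lemma IsNodal.ideal_eq_bot {k : Type*} [Field k] {σ : k →+* Γ(X, ⊤)} {I J : X.IdealSheafData}
    (h : IsNodal σ I J) (U : X.affineOpens)
    (hU : ∀ x ∈ U.1, x ∉ J.support) : I.ideal U = ⊥ := by
  have := congr_arg (fun K ↦ IdealSheafData.ideal K U) h.inf_eq_bot
  simpa [ideal_eq_top_of_disjoint_support J U hU] using this

/-- The complement of the support of an ideal sheaf. -/
def coSupport (J : X.IdealSheafData) : X.Opens := J.support.compl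

/-! ### Links between line bundles and the relation defining a lift. -/

namespace Modules

/-- Two line bundles linked by morphisms with prescribed kernels and images. -/
structure IsLink (I J : X.IdealSheafData) {M M' : X.Modules} (up : M ⟶ M') (down : M' ⟶ M) :
    Prop where
  lineBundle : M.IsLineBundle
  lineBundle' : M'.IsLineBundle
  kernel_up : KernelIs up J
  image_up : ImageIs up I
  kernel_down : KernelIs down I
  image_down : ImageIs down J

variable {k : Type*} [Field k] {σ : k →+* Γ(X, ⊤)} {I J : X.IdealSheafData}
  {M M' Q Q' : X.Modules} {up : M ⟶ M'} {down : M' ⟶ M}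
  {up' : Q ⟶ Q'} {down' : Q' ⟶ Q}

lemma IsLink.symm (l : IsLink I J up down) : IsLink J I down up :=
  ⟨l.lineBundle', l.lineBundle, l.kernel_down, l.image_down, l.kernel_up, l.image_up⟩

lemma exists_affine_le {U : X.Opens} {x : X} (hx : x ∈ U) :
    ∃ V : X.affineOpens, x ∈ V.1 ∧ V.1 ≤ U := by
  obtain ⟨_, ⟨V, hV, rfl⟩, hxV, hVU⟩ :=
    X.isBasis_affineOpens.exists_subset_of_mem_open hx U.isOpen
  exact ⟨⟨V, hV⟩, hxV, hVU⟩

lemma app_injective_of_affine (φ : M ⟶ M') {U : X.Opens}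
    (h : ∀ V : X.affineOpens, V.1 ≤ U → ∀ s, φ.app V.1 s = 0 → s = 0) :
    Function.Injective (φ.app U) := by
  refine (injective_iff_map_eq_zero (φ.app U).hom).mpr fun s hs ↦ ?_
  refine eq_zero_of_locally fun x hx ↦ ?_
  obtain ⟨V, hxV, hVU⟩ := exists_affine_le hx
  refine ⟨V.1, hVU, hxV, h V hVU _ ?_⟩
  have hs : φ.app U s = 0 := hs
  rw [← res_app, hs, map_zero]

lemma IsLink.down_app_injective (l : IsLink I J up down) (hn : IsNodal σ I J) {U : X.Opens}
    (hU : U ≤ coSupport J) : Function.Injective (down.app U) :=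
  app_injective_of_affine down fun V hV s hs ↦ by
    have := (l.kernel_down V s).mp hs
    rw [idealMul, hn.ideal_eq_bot V fun x hx ↦ hU (hV hx)] at this
    simpa using this

/-- The image of `down` is `J · M`, which is all of `M` off the support of `J`. The image condition
only provides preimages over affine opens; injectivity of `down` glues them. -/
lemma IsLink.down_app_surjective (l : IsLink I J up down) (hn : IsNodal σ I J) {U : X.Opens}
    (hU : U ≤ coSupport J) : Function.Surjective (down.app U) := fun t ↦ by
  obtain ⟨s, hs⟩ := exists_glue (M := M') (U := U) (fun V hV s ↦ down.app V s = M.res hV t)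
    (fun V W hV h s hs ↦ by rw [← res_app, hs, res_res])
    (fun V hV s s' hs hs' ↦ l.down_app_injective hn (hV.trans hU) (hs.trans hs'.symm))
    (fun x hx ↦ by
      obtain ⟨V, hxV, hVU⟩ := exists_affine_le hx
      refine ⟨V.1, hVU, hxV, (l.image_down V _).mpr ?_⟩
      rw [idealMul, ideal_eq_top_of_disjoint_support J V fun x hx ↦ hU (hVU hx)]
      simp)
  refine ⟨s, eq_of_locally_eq fun x hx ↦ ?_⟩
  obtain ⟨V, hV, hxV, h⟩ := hs x hx
  exact ⟨V, hV, hxV, by rw [res_app, h]⟩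

lemma IsLink.down_up (l : IsLink I J up down) {U : X.Opens} (s : Γ(M, U)) :
    down.app U (up.app U s) = 0 := by
  refine eq_zero_of_locally fun x hx ↦ ?_
  obtain ⟨V, hxV, hVU⟩ := exists_affine_le hx
  refine ⟨V.1, hVU, hxV, ?_⟩
  rw [res_app, res_app]
  exact (l.kernel_down V _).mpr ((l.image_up V _).mp ⟨_, rfl⟩)

/-- In a local trivialisation the coordinate of `t` lies in `I`, so it vanishes at every point of
the support of `I`, and by assumption it vanishes off that support. On a reduced scheme such a
function is zero. -/
lemma IsLink.eq_zero (l : IsLink I J up down) [IsReduced X] {U : X.Opens} {t : Γ(M', U)}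
    (h : down.app U t = 0)
    (h' : M'.res (inf_le_left : U ⊓ coSupport I ≤ U) t = 0) : t = 0 := by
  refine eq_zero_of_locally fun x hx ↦ ?_
  obtain ⟨V, hxV, hVU, e, he⟩ := l.lineBundle'.exists_generator hx
  refine ⟨V.1, hVU, hxV, ?_⟩
  obtain ⟨a, ha : a • e = _⟩ := he.bijective.2 (M'.res hVU t)
  have haI : a ∈ I.ideal V := by
    rw [← he.mem_idealMul_iff, ha, ← l.kernel_down V, ← res_app, h, map_zero]
  have hle : V.1 ⊓ coSupport I ≤ V.1 := inf_le_left
  have ha0 : X.fres hle a = 0 := by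
    refine (he _ hle).1 ?_
    change X.fres hle a • M'.res hle e = (0 : Γ(X, V.1 ⊓ coSupport I)) • M'.res hle e
    rw [← res_smul, ha, zero_smul, res_res,
      ← res_res M' (inf_le_left : U ⊓ coSupport I ≤ U) (inf_le_inf_right _ hVU), h', map_zero]
  suffices a = 0 by rw [← ha, this, zero_smul]
  rw [← AlgebraicGeometry.basicOpen_eq_bot_iff, eq_bot_iff]
  intro y hy
  have hyV : y ∈ V.1 := X.basicOpen_le a hy
  have hyI : y ∈ coSupport I := fun hyI ↦ notMem_basicOpen_of_mem_ideal hyV hyI haI hy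
  have h1 : y ∈ X.basicOpen (X.fres hle a) := by
    rw [fres, Scheme.basicOpen_res]
    exact ⟨⟨hyV, hyI⟩, hy⟩
  simp [ha0] at h1

/-- `ι` is an isomorphism away from the point `p`, and injective everywhere. -/
structure IsModification (p : X) (ι : Q ⟶ M) : Prop where
  injective : ∀ U, Function.Injective (ι.app U)
  surjective : ∀ U, p ∉ U → Function.Surjective (ι.app U)

/-- The relation between sections of `Q'` and of `M'` given by a morphism `Q' ⟶ M'` compatible
with `ι` and, up to the scalar `c`, with the links. -/
def LinkRel (I : X.IdealSheafData) (up : M ⟶ M') (down : M' ⟶ M) (up' : Q ⟶ Q') (down' : Q' ⟶ Q)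
    (ι : Q ⟶ M) (c : Γ(X, ⊤)) (V : X.Opens) (s : Γ(Q', V)) (t : Γ(M', V)) : Prop :=
  down.app V t = ι.app V (down'.app V s) ∧
    ∀ (W : X.Opens) (h : W ≤ V), W ≤ coSupport I → ∀ r : Γ(Q, W), up'.app W r = Q'.res h s →
      M'.res h t = X.fres (le_top : W ≤ ⊤) c • up.app W (ι.app W r)

section

variable {ι : Q ⟶ M} {c : Γ(X, ⊤)} {V : X.Opens}

lemma LinkRel.res {s : Γ(Q', V)} {t : Γ(M', V)} (H : LinkRel I up down up' down' ι c V s t)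
    {W : X.Opens} (h : W ≤ V) :
    LinkRel I up down up' down' ι c W (Q'.res h s) (M'.res h t) := by
  refine ⟨by rw [← res_app, H.1, res_app, res_app], fun W' h' hI r hr ↦ ?_⟩
  rw [res_res] at hr ⊢
  exact H.2 W' _ hI r hr

lemma LinkRel.add (l' : IsLink I J up' down') (hn : IsNodal σ I J)
    {s₁ s₂ : Γ(Q', V)} {t₁ t₂ : Γ(M', V)}
    (H₁ : LinkRel I up down up' down' ι c V s₁ t₁) (H₂ : LinkRel I up down up' down' ι c V s₂ t₂) :
    LinkRel I up down up' down' ι c V (s₁ + s₂) (t₁ + t₂) := by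
  refine ⟨by simp only [map_add, H₁.1, H₂.1], fun W h hI r hr ↦ ?_⟩
  obtain ⟨r₁, h₁⟩ := l'.symm.down_app_surjective hn.symm hI (Q'.res h s₁)
  obtain ⟨r₂, h₂⟩ := l'.symm.down_app_surjective hn.symm hI (Q'.res h s₂)
  obtain rfl : r = r₁ + r₂ := l'.symm.down_app_injective hn.symm hI (by
    rw [hr, map_add, map_add, h₁, h₂])
  rw [map_add, H₁.2 W h hI r₁ h₁, H₂.2 W h hI r₂ h₂, map_add, map_add, smul_add]

lemma LinkRel.smul (l' : IsLink I J up' down') (hn : IsNodal σ I J) (a : Γ(X, V))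
    {s : Γ(Q', V)} {t : Γ(M', V)} (H : LinkRel I up down up' down' ι c V s t) :
    LinkRel I up down up' down' ι c V (a • s) (a • t) := by
  refine ⟨by simp only [Hom.app_smul, H.1], fun W h hI r hr ↦ ?_⟩
  obtain ⟨r₁, h₁⟩ := l'.symm.down_app_surjective hn.symm hI (Q'.res h s)
  obtain rfl : r = X.fres h a • r₁ := l'.symm.down_app_injective hn.symm hI (by
    rw [hr, Hom.app_smul, res_smul, h₁])
  rw [res_smul, H.2 W h hI r₁ h₁, Hom.app_smul, Hom.app_smul, smul_comm]

/-- Uniqueness makes the lift a well-defined map: it yields additivity, linearity, and the gluing of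
local solutions. -/
lemma LinkRel.unique (l : IsLink I J up down) (l' : IsLink I J up' down') (hn : IsNodal σ I J)
    [IsReduced X] {s : Γ(Q', V)} {t t' : Γ(M', V)}
    (H : LinkRel I up down up' down' ι c V s t) (H' : LinkRel I up down up' down' ι c V s t') :
    t = t' := by
  rw [← sub_eq_zero]
  refine l.eq_zero (by rw [map_sub, H.1, H'.1, sub_self]) ?_
  obtain ⟨r, hr⟩ := l'.symm.down_app_surjective hn.symm inf_le_right
    (Q'.res (inf_le_left : V ⊓ coSupport I ≤ V) s)
  rw [map_sub, H.2 _ _ inf_le_right r hr, H'.2 _ _ inf_le_right r hr, sub_self]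

lemma LinkRel.of_locally {s : Γ(Q', V)} {t : Γ(M', V)}
    (H : ∀ x ∈ V, ∃ (W : X.Opens) (h : W ≤ V), x ∈ W ∧
      LinkRel I up down up' down' ι c W (Q'.res h s) (M'.res h t)) :
    LinkRel I up down up' down' ι c V s t := by
  refine ⟨eq_of_locally_eq fun x hx ↦ ?_, fun W h hI r hr ↦ eq_of_locally_eq fun x hx ↦ ?_⟩
  · obtain ⟨W, h, hxW, HW⟩ := H x hx
    exact ⟨W, h, hxW, by rw [res_app, HW.1, res_app, res_app]⟩
  · obtain ⟨W', h', hxW, HW⟩ := H x (h hx)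
    refine ⟨W ⊓ W', inf_le_left, ⟨hx, hxW⟩, ?_⟩
    have := HW.2 (W ⊓ W') inf_le_right (inf_le_left.trans hI) (Q.res inf_le_left r) (by
      rw [← res_app, hr, res_res, res_res])
    rw [res_res] at this ⊢
    rw [this, res_smul, fres_fres, res_app, res_app]

/-- Off the support of `I`, where `up'` is invertible, this is the explicit solution. Globally it
gives the compatibility of the lift with `up`. -/
lemma LinkRel.of_up (l : IsLink I J up down) (l' : IsLink I J up' down') (hn : IsNodal σ I J)
    (r : Γ(Q, V)) :
    LinkRel I up down up' down' ι c V (up'.app V r)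
      (X.fres (le_top : V ≤ ⊤) c • up.app V (ι.app V r)) := by
  refine ⟨by rw [Hom.app_smul, l.down_up, l'.down_up, smul_zero, map_zero],
    fun W h hI r' hr' ↦ ?_⟩
  obtain rfl : r' = Q.res h r := l'.symm.down_app_injective hn.symm hI (by rw [hr', res_app])
  rw [res_smul, fres_fres, res_app, res_app]

end

end Modules

end AlgebraicGeometry.Scheme

/-! ### Lifting a modification along a link. -/

namespace AlgebraicGeometry.Scheme.Modules

variable {X : Scheme.{u}} {k : Type*} [Field k] {σ : k →+* Γ(X, ⊤)} 
  {I J : X.IdealSheafData} {M M' Q Q' : X.Modules} {up : M ⟶ M'}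
  {down : M' ⟶ M} {up' : Q ⟶ Q'} {down' : Q' ⟶ Q} {ι : Q ⟶ M}

/-- In terms of generators, a link is given by generators of the two ideals annihilating each
other. -/
lemma IsLink.exists_coeff (l : IsLink I J up down) {U : X.affineOpens} {e : Γ(M, U.1)}
    {e' : Γ(M', U.1)} (he : M.IsGenerator e) (he' : M'.IsGenerator e') :
    ∃ α : Γ(X, U.1), up.app U.1 e = α • e' ∧ (∀ a, a ∈ I.ideal U ↔ ∃ b, b * α = a) ∧
      ∀ a, a * α = 0 ↔ a ∈ J.ideal U := by
  obtain ⟨α, hα : α • e' = _⟩ := he'.bijective.2 (up.app U.1 e)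
  refine ⟨α, hα.symm, fun a ↦ ?_, fun a ↦ ?_⟩
  · rw [← he'.mem_idealMul_iff, ← l.image_up U]
    constructor
    · rintro ⟨s, hs⟩
      obtain ⟨b, rfl⟩ := he.bijective.2 s
      refine ⟨b, he'.bijective.1 ?_⟩
      dsimp only at hs ⊢
      rw [← hs, Hom.app_smul, ← hα, mul_smul]
    · rintro ⟨b, rfl⟩
      exact ⟨b • e, by rw [Hom.app_smul, ← hα, mul_smul]⟩
  · rw [← he.mem_idealMul_iff, ← l.kernel_up U, Hom.app_smul, ← hα, ← mul_smul]
    constructor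
    · intro h
      rw [h, zero_smul]
    · intro h
      refine he'.bijective.1 ?_
      simpa using h

/-- The local computation at the node. If the links have matrices `α, β` and `α', β'`, and `ι` is
multiplication by `γ`, then the lift is multiplication by some `δ` with `δ * α' = c * γ * α` and `δ
* β = β' * γ`. The second equation determines `δ` modulo `I`, with solution `w * γ`; the first can
then be met by a correction in `I` as soon as `w * u` and `c` agree modulo `I ⊔ J`. -/
lemma exists_local_coeff {R : Type*} [CommRing R] {I J : Ideal R} {α α' β β' : R}
    (hα : ∀ a, a ∈ I ↔ ∃ b, b * α = a) (hα0 : ∀ a, a * α = 0 ↔ a ∈ J)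
    (hα' : ∀ a, a ∈ I ↔ ∃ b, b * α' = a)
    (hβ : ∀ a, a ∈ J ↔ ∃ b, b * β = a) (hβ0 : ∀ a, a * β = 0 ↔ a ∈ I)
    (hβ' : ∀ a, a ∈ J ↔ ∃ b, b * β' = a) :
    ∃ u v w z : R, u * v - 1 ∈ J ∧ w * z - 1 ∈ I ∧ ∀ γ c, w * u - c ∈ I ⊔ J →
      ∃ y ∈ I, (w * γ + y) * α' = c * γ * α ∧ (w * γ + y) * β = β' * γ := by
  obtain ⟨u, hu⟩ := (hα α').mp ((hα' α').mpr ⟨1, one_mul _⟩)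
  obtain ⟨v, hv⟩ := (hα' α).mp ((hα α).mpr ⟨1, one_mul _⟩)
  obtain ⟨w, hw⟩ := (hβ β').mp ((hβ' β').mpr ⟨1, one_mul _⟩)
  obtain ⟨z, hz⟩ := (hβ' β).mp ((hβ β).mpr ⟨1, one_mul _⟩)
  have huv : u * v - 1 ∈ J := (hα0 _).mp (by linear_combination v * hu + hv)
  have hwz : w * z - 1 ∈ I := (hβ0 _).mp (by linear_combination z * hw + hz)
  refine ⟨u, v, w, z, huv, hwz, fun γ c hc ↦ ?_⟩
  -- The term `q` of `w * u - c = p + q` is killed by `α`. The correction `-(p * γ * v)` cancels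
  -- `p`, since `u * v` is `1` modulo the annihilator `J` of `α`.
  obtain ⟨p, hp, q, hq, hpq⟩ := Submodule.mem_sup.mp hc
  refine ⟨-(p * γ * v), neg_mem (Ideal.mul_mem_right _ _ (Ideal.mul_mem_right _ _ hp)), ?_, ?_⟩
  · have h1 := (hα0 _).mpr huv
    have h2 := (hα0 _).mpr hq
    linear_combination -(w * γ - p * γ * v) * hu - γ * α * hpq - p * γ * h1 + γ * h2
  · have h1 := (hβ0 _).mpr hp
    linear_combination γ * hw - γ * v * h1

/-- Near a point of intersection, a modification lifts along links. -/
lemma exists_linkRel_generator (l : IsLink I J up down) (l' : IsLink I J up' down')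
    (hn : IsNodal σ I J) {p : X} (hp : IsClosed {p}) (hι : IsModification p ι) {x : X} (hxp : x ≠ p)
    (hxI : x ∈ I.support) (hxJ : x ∈ J.support) :
    ∃ c : k, c ≠ 0 ∧ ∃ (U : X.Opens) (δ : Γ(X, U)) (e' : Γ(M', U)) (f' : Γ(Q', U)),
      x ∈ U ∧ IsUnit δ ∧ M'.IsGenerator e' ∧ Q'.IsGenerator f' ∧
        LinkRel I up down up' down' ι (σ c) U f' (δ • e') := by
  -- Shrink to one affine neighbourhood of `x` that trivialises all four bundles and avoids `p`, so
  -- that `ι` is invertible on it.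
  obtain ⟨U₁, hx₁, hU₁, e₁, he₁⟩ :=
    l.lineBundle.exists_generator (U := ⟨{p}ᶜ, hp.isOpen_compl⟩) (x := x) hxp
  obtain ⟨U₂, hx₂, hU₂, e₂, he₂⟩ := l.lineBundle'.exists_generator hx₁
  obtain ⟨U₃, hx₃, hU₃, e₃, he₃⟩ := l'.lineBundle.exists_generator hx₂
  obtain ⟨U, hx, hU, f', hf'⟩ := l'.lineBundle'.exists_generator hx₃
  obtain ⟨e, he⟩ : ∃ e : Γ(M, U.1), M.IsGenerator e :=
    ⟨_, he₁.res ((hU.trans hU₃).trans hU₂)⟩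
  obtain ⟨e', he'⟩ : ∃ e : Γ(M', U.1), M'.IsGenerator e := ⟨_, he₂.res (hU.trans hU₃)⟩
  obtain ⟨f, hf⟩ : ∃ e : Γ(Q, U.1), Q.IsGenerator e := ⟨_, he₃.res hU⟩
  have hpU : p ∉ U.1 := fun h ↦ hU₁ (hU₂ (hU₃ (hU h))) rfl
  clear! U₁ U₂ U₃
  obtain ⟨α, hαe, hα, hα0⟩ := l.exists_coeff he he'
  obtain ⟨β, hβe, hβ, hβ0⟩ := l.symm.exists_coeff he' he
  obtain ⟨α', hαe', hα', -⟩ := l'.exists_coeff hf hf'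
  obtain ⟨β', hβe', hβ', -⟩ := l'.symm.exists_coeff hf' hf
  obtain ⟨u, v, w, z, huv, hwz, H⟩ := exists_local_coeff hα hα0 hα' hβ hβ0 hβ'
  obtain ⟨γ, hγ : γ • e = _⟩ := he.bijective.2 (ι.app U.1 f)
  let ev := (X.evaluation U.1 x hx).hom
  have hevI : ∀ a ∈ I.ideal U, ev a = 0 := fun a ha ↦ evaluation_eq_zero_of_mem_ideal hx hxI ha
  have hevJ : ∀ a ∈ J.ideal U, ev a = 0 := fun a ha ↦ evaluation_eq_zero_of_mem_ideal hx hxJ ha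
  have hmem : ∀ a, x ∈ X.basicOpen a ↔ ev a ≠ 0 := fun a ↦
    (X.evaluation_ne_zero_iff_mem_basicOpen x hx a).symm
  have hu0 : ev u ≠ 0 := by
    have := hevJ _ huv
    rw [map_sub, map_mul, map_one, sub_eq_zero] at this
    exact left_ne_zero_of_mul_eq_one this
  have hw0 : ev w ≠ 0 := by
    have := hevI _ hwz
    rw [map_sub, map_mul, map_one, sub_eq_zero] at this
    exact left_ne_zero_of_mul_eq_one this
  have hγ0 : ev γ ≠ 0 := by
    obtain ⟨t, ht⟩ := hι.surjective U.1 hpU e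
    obtain ⟨a, rfl⟩ := hf.bijective.2 t
    have : a * γ = 1 := he.bijective.1 (by
      dsimp only at ht ⊢
      rw [mul_smul, hγ, ← Hom.app_smul, ht, one_smul])
    have := congr_arg ev this
    rw [map_mul, map_one] at this
    exact right_ne_zero_of_mul_eq_one this
  -- The constant is the value of `w * u` at the node, nonzero because `u` and `w` are invertible
  -- there.
  obtain ⟨c, hc, hcI⟩ := hn.exists_const U x hx hxI hxJ (w * u)
    ((hmem _).mpr (by rw [map_mul]; exact mul_ne_zero hw0 hu0))
  obtain ⟨y, hy, h1, h2⟩ := H γ _ hcI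
  set δ := w * γ + y
  -- The correction `y` lies in `I` and so vanishes at `x`; hence `δ` is invertible near `x`, which
  -- later gives surjectivity of the lift.
  have hδ : x ∈ X.basicOpen δ := (hmem _).mpr (by
    rw [map_add, map_mul, hevI y hy, add_zero]; exact mul_ne_zero hw0 hγ0)
  have hrel : LinkRel I up down up' down' ι (σ c) U.1 f' (δ • e') := by
    refine ⟨?_, fun W h hI r hr ↦ ?_⟩
    · rw [Hom.app_smul, hβe, ← mul_smul, h2, hβe', Hom.app_smul, ← hγ, mul_smul]
    · obtain ⟨b, rfl⟩ := (hf W h).2 r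
      dsimp only at hr ⊢
      rw [Hom.app_smul, ← res_app, hαe', res_smul, ← mul_smul] at hr
      have hb : b * X.fres h α' = 1 := (hf' W h).1 (by
        dsimp only
        rw [hr, one_smul])
      have h3 := congr_arg (X.fres h) h1
      simp only [map_mul, fres_fres] at h3
      rw [res_smul, Hom.app_smul, Hom.app_smul, ← res_app, ← hγ, res_smul, Hom.app_smul, ← res_app,
        hαe, res_smul, ← mul_smul, ← mul_smul, ← mul_smul]
      congr 1
      linear_combination b * h3 - X.fres h δ * hb
  have hle := X.basicOpen_le δ
  refine ⟨c, hc, X.basicOpen δ, X.fres hle δ, M'.res hle e', Q'.res hle f', hδ,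
    isUnit_fres_of_le_basicOpen _ _ le_rfl, he'.res _, hf'.res _, ?_⟩
  rw [← res_smul]
  exact hrel.res _

/-- The compatibility of two morphisms with links, up to nonzero constants. -/
structure LinkCompat (σ : k →+* Γ(X, ⊤)) (up : M ⟶ M') (down : M' ⟶ M) (up' : Q ⟶ Q')
    (down' : Q' ⟶ Q) (ι : Q ⟶ M) (ι' : Q' ⟶ M') : Prop where
  up : ∃ c : k, c ≠ 0 ∧ ∀ U (s : Γ(Q, U)),
    ι'.app U (up'.app U s) = X.fres (le_top : U ≤ ⊤) (σ c) • up.app U (ι.app U s)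
  down : ∃ c : k, c ≠ 0 ∧ ∀ U (s : Γ(Q', U)),
    ι.app U (down'.app U s) = X.fres (le_top : U ≤ ⊤) (σ c) • down.app U (ι'.app U s)

/-- A modification lifts along links, uniquely up to the choice of a scalar. -/
theorem IsModification.exists_lift [IsReduced X] (l : IsLink I J up down)
    (l' : IsLink I J up' down') (hn : IsNodal σ I J) {p : X} (hp : IsClosed {p})
    (hpIJ : p ∈ I.support → p ∉ J.support) (hι : IsModification p ι) :
    ∃ ι' : Q' ⟶ M', IsModification p ι' ∧ LinkCompat σ up down up' down' ι ι' := by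
  -- A single constant suffices because there is at most one node; without a node any nonzero
  -- constant would do.
  obtain ⟨c, hc, hloc⟩ : ∃ c : k, c ≠ 0 ∧ ∀ x, x ∈ I.support → x ∈ J.support →
      ∃ (U : X.Opens) (δ : Γ(X, U)) (e' : Γ(M', U)) (f' : Γ(Q', U)),
        x ∈ U ∧ IsUnit δ ∧ M'.IsGenerator e' ∧ Q'.IsGenerator f' ∧
          LinkRel I up down up' down' ι (σ c) U f' (δ • e') := by
    by_cases h : ∃ x, x ∈ I.support ∧ x ∈ J.support
    · obtain ⟨x, hxI, hxJ⟩ := h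
      obtain ⟨c, hc, H⟩ := exists_linkRel_generator l l' hn hp hι
        (fun h ↦ hpIJ (h ▸ hxI) (h ▸ hxJ)) hxI hxJ
      exact ⟨c, hc, fun y hyI hyJ ↦ hn.subsingleton x y hxI hxJ hyI hyJ ▸ H⟩
    · exact ⟨1, one_ne_zero, fun x hxI hxJ ↦ (h ⟨x, hxI, hxJ⟩).elim⟩
  have hex : ∀ (V : X.Opens) (s : Γ(Q', V)), ∃ t, LinkRel I up down up' down' ι (σ c) V s t := by
    intro V s
    obtain ⟨t, ht⟩ := exists_glue (M := M') (U := V)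
      (fun W hW t ↦ LinkRel I up down up' down' ι (σ c) W (Q'.res hW s) t)
      (fun W W' hW h t ht ↦ by simpa using ht.res h)
      (fun W hW t t' ht ht' ↦ ht.unique l l' hn ht')
      (fun x hx ↦ by
        -- Local solutions: at the node use the generator computation, off `I` transport along `up`,
        -- off `J` invert `down`. In the last case the `up` condition is automatic, since the
        -- injective map `down` kills both sides.
        by_cases hxJ : x ∈ J.support
        · by_cases hxI : x ∈ I.support
          · obtain ⟨U, δ, e', f', hxU, -, -, hf', H⟩ := hloc x hxI hxJ
            obtain ⟨a, ha⟩ := (hf' (V ⊓ U) inf_le_right).2 (Q'.res inf_le_left s)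
            refine ⟨V ⊓ U, inf_le_left, ⟨hx, hxU⟩, a • M'.res inf_le_right (δ • e'), ?_⟩
            rw [← ha]
            exact (H.res inf_le_right).smul l' hn a
          · obtain ⟨r, hr⟩ := l'.symm.down_app_surjective hn.symm (U := V ⊓ coSupport I)
              inf_le_right (Q'.res inf_le_left s)
            refine ⟨V ⊓ coSupport I, inf_le_left, ⟨hx, hxI⟩,
              X.fres (le_top : V ⊓ coSupport I ≤ ⊤) (σ c) • up.app _ (ι.app _ r), ?_⟩
            rw [← hr]
            exact .of_up l l' hn r
        · obtain ⟨t, ht⟩ := l.down_app_surjective hn (U := V ⊓ coSupport J)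
            inf_le_right (ι.app _ (down'.app _ (Q'.res inf_le_left s)))
          refine ⟨V ⊓ coSupport J, inf_le_left, ⟨hx, hxJ⟩, t, ht, fun W h hI r hr ↦ ?_⟩
          refine l.down_app_injective hn (h.trans inf_le_right) ?_
          rw [← res_app, ht, Hom.app_smul, l.down_up, res_app, res_app, ← hr, l'.down_up,
            map_zero, smul_zero])
    exact ⟨t, .of_locally ht⟩
  choose φ hφ using hex
  have hφu : ∀ {V : X.Opens} {s : Γ(Q', V)} {t}, LinkRel I up down up' down' ι (σ c) V s t →
      φ V s = t := fun h ↦ (hφ _ _).unique l l' hn h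
  let ι' : Q' ⟶ M' := homOfSections φ (fun U s t ↦ hφu ((hφ U s).add l' hn (hφ U t)))
    (fun U a s ↦ hφu ((hφ U s).smul l' hn a)) (fun U V h s ↦ (hφu ((hφ U s).res h)).symm)
  have hι' : ∀ U s, ι'.app U s = φ U s := fun _ _ ↦ rfl
  have hdown : ∀ U (s : Γ(Q', U)), down.app U (ι'.app U s) = ι.app U (down'.app U s) :=
    fun U s ↦ (hφ U s).1
  have hup : ∀ U (s : Γ(Q, U)),
      ι'.app U (up'.app U s) = X.fres (le_top : U ≤ ⊤) (σ c) • up.app U (ι.app U s) :=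
    fun U s ↦ hφu (.of_up l l' hn s)
  have hcU : ∀ U : X.Opens, IsUnit (X.fres (le_top : U ≤ ⊤) (σ c)) := fun U ↦
    ((IsUnit.mk0 c hc).map σ).map _
  have hinj : ∀ U, Function.Injective (ι'.app U) := by
    intro U
    refine (injective_iff_map_eq_zero (ι'.app U).hom).mpr fun s (hs : ι'.app U s = 0) ↦ ?_
    refine l'.eq_zero (hι.injective U ?_) ?_
    · rw [← hdown, hs, map_zero, map_zero]
    · obtain ⟨r, hr⟩ := l'.symm.down_app_surjective hn.symm (U := U ⊓ coSupport I)
        inf_le_right (Q'.res inf_le_left s)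
      have h := hup _ r
      rw [hr, ← res_app, hs, map_zero, eq_comm, (hcU _).smul_eq_zero] at h
      have h2 := hι.injective _ (l.symm.down_app_injective hn.symm inf_le_right
        (h.trans (map_zero _).symm) |>.trans (map_zero _).symm)
      rw [← hr, h2, map_zero]
  refine ⟨ι', ⟨hinj, fun V hpV t ↦ app_surjective_of_locally ι' hinj t fun x hx ↦ ?_⟩, 
    ⟨c, hc, hup⟩, ⟨1, one_ne_zero, fun U s ↦ by simp [hdown]⟩⟩
  by_cases hxJ : x ∈ J.support
  · by_cases hxI : x ∈ I.support
    · obtain ⟨U, δ, e', f', hxU, hδ, he', -, H⟩ := hloc x hxI hxJ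
      refine ⟨V ⊓ U, inf_le_left, ⟨hx, hxU⟩, ?_⟩
      obtain ⟨a, ha⟩ := (he' (V ⊓ U) inf_le_right).2 (M'.res inf_le_left t)
      obtain ⟨b, hb⟩ := (hδ.map (X.fres (inf_le_right : V ⊓ U ≤ U))).exists_left_inv
      refine ⟨(a * b) • Q'.res inf_le_right f', ?_⟩
      rw [Hom.app_smul, hι', hφu (H.res inf_le_right), ← ha, res_smul, ← mul_smul, mul_assoc, hb,
        mul_one]
    · refine ⟨V ⊓ coSupport I, inf_le_left, ⟨hx, hxI⟩, ?_⟩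
      obtain ⟨m, hm⟩ := l.symm.down_app_surjective hn.symm (U := V ⊓ coSupport I)
        inf_le_right (M'.res inf_le_left t)
      obtain ⟨r, rfl⟩ := hι.surjective (V ⊓ coSupport I) (fun h ↦ hpV h.1) m
      obtain ⟨b, hb⟩ := (hcU (V ⊓ coSupport I)).exists_left_inv
      exact ⟨b • up'.app _ r, by rw [Hom.app_smul, hup, hm, ← mul_smul, hb, one_smul]⟩
  · refine ⟨V ⊓ coSupport J, inf_le_left, ⟨hx, hxJ⟩, ?_⟩
    obtain ⟨r, hr⟩ := hι.surjective _ (fun h : p ∈ V ⊓ coSupport J ↦ hpV h.1)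
      (down.app _ (M'.res inf_le_left t))
    obtain ⟨s, rfl⟩ := l'.down_app_surjective hn inf_le_right r
    exact ⟨s, l.down_app_injective hn inf_le_right (by rw [hdown, hr])⟩

lemma smul_fres_inv_smul {M : X.Modules} {c : k} (hc : c ≠ 0) {U : X.Opens} (s : Γ(M, U)) :
    X.fres (le_top : U ≤ ⊤) (σ c) • X.fres (le_top : U ≤ ⊤) (σ c⁻¹) • s = s := by
  rw [← mul_smul, ← map_mul, ← map_mul, mul_inv_cancel₀ hc, map_one, map_one, one_smul]

lemma smul_fres_eq_iff {M : X.Modules} {c : k} (hc : c ≠ 0) {U : X.Opens} {s t : Γ(M, U)} :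
    s = X.fres (le_top : U ≤ ⊤) (σ c) • t ↔ X.fres (le_top : U ≤ ⊤) (σ c⁻¹) • s = t := by
  have h := smul_fres_inv_smul (σ := σ) (M := M) (U := U) (inv_ne_zero hc)
  rw [inv_inv] at h
  constructor
  · rintro rfl
    exact h t
  · rintro rfl
    exact (smul_fres_inv_smul hc s).symm

lemma LinkCompat.symm {ι : Q ⟶ M} {ι' : Q' ⟶ M'} (h : LinkCompat σ up down up' down' ι ι') :
    LinkCompat σ down up down' up' ι' ι := ⟨h.down, h.up⟩

/-! ### Transport of the codimension condition along links. -/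

/-- Sections whose image under `down` lifts along a modification lift themselves, if the point of
modification is where `down` is an isomorphism. -/
lemma LinkCompat.exists_of_down (l : IsLink I J up down) (l' : IsLink I J up' down')
    (hn : IsNodal σ I J) {p : X} (hp : p ∉ J.support) (hp' : IsClosed {p}) {ι' : Q' ⟶ M'}
    (hι' : IsModification p ι') (H : LinkCompat σ up down up' down' ι ι')
    {U : X.Opens} {t : Γ(M', U)} (h : ∃ s, ι.app U s = down.app U t) : ∃ s, ι'.app U s = t := by
  obtain ⟨c, hc, hdown⟩ := H.down
  refine app_surjective_of_locally ι' hι'.injective t fun x hx ↦ ?_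
  -- Points of the support of `J` differ from `p`, and away from `p` everything lifts. Off that
  -- support `down` and `down'` are invertible, so the given lift of `down t` can be transported
  -- back.
  by_cases hxJ : x ∈ J.support
  · let W : X.Opens := ⟨{p}ᶜ, hp'.isOpen_compl⟩
    have hxW : x ∈ W := fun h : x = p ↦ hp (h ▸ hxJ)
    exact ⟨U ⊓ W, inf_le_left, ⟨hx, hxW⟩, hι'.surjective (U ⊓ W) (fun h ↦ h.2 rfl) _⟩
  · obtain ⟨r, hr⟩ := h
    refine ⟨U ⊓ coSupport J, inf_le_left, ⟨hx, hxJ⟩, ?_⟩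
    obtain ⟨s, hs⟩ := l'.down_app_surjective hn inf_le_right
      (Q.res (inf_le_left : U ⊓ coSupport J ≤ U) r)
    refine ⟨X.fres (le_top : U ⊓ coSupport J ≤ ⊤) (σ c) • s,
      l.down_app_injective hn inf_le_right ?_⟩
    rw [Hom.app_smul, Hom.app_smul, ← hdown, hs, ← res_app, hr, res_app]

/-- Any two sections have a nontrivial combination with constant coefficients which lifts. -/
def IsCodimLEOne (σ : k →+* Γ(X, ⊤)) (ι : Q ⟶ M) : Prop :=
  ∀ (U : X.Opens) (s t : Γ(M, U)), ∃ a b : k, (a ≠ 0 ∨ b ≠ 0) ∧ ∃ q, ι.app U q =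
    X.fres (le_top : U ≤ ⊤) (σ a) • s + X.fres (le_top : U ≤ ⊤) (σ b) • t

lemma LinkCompat.isCodimLEOne (l : IsLink I J up down) (l' : IsLink I J up' down')
    (hn : IsNodal σ I J) {p : X} (hp : p ∉ J.support) (hp' : IsClosed {p}) {ι' : Q' ⟶ M'}
    (hι' : IsModification p ι') (H : LinkCompat σ up down up' down' ι ι')
    (h : IsCodimLEOne σ ι) : IsCodimLEOne σ ι' := by
  intro U s t
  obtain ⟨a, b, hab, q, hq⟩ := h U (down.app U s) (down.app U t)
  refine ⟨a, b, hab, H.exists_of_down l l' hn hp hp' hι' ⟨q, ?_⟩⟩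
  rw [hq, map_add, Hom.app_smul, Hom.app_smul]

/-- The condition `IsCodimLEOne` only has to be checked near the modified point. -/
lemma IsModification.isCodimLEOne {p : X} (hι : IsModification p ι) (hp : IsClosed {p})
    (h : ∀ (U : X.Opens) (s t : Γ(M, U)), ∃ (V : X.Opens) (hV : V ≤ U), (p ∈ U → p ∈ V) ∧
      ∃ a b : k, (a ≠ 0 ∨ b ≠ 0) ∧ ∃ q, ι.app V q = X.fres (le_top : V ≤ ⊤) (σ a) • M.res hV s +
        X.fres (le_top : V ≤ ⊤) (σ b) • M.res hV t) : IsCodimLEOne σ ι := by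
  intro U s t
  obtain ⟨V, hV, hpV, a, b, hab, q, hq⟩ := h U s t
  refine ⟨a, b, hab, app_surjective_of_locally ι hι.injective _ fun x hx ↦ ?_⟩
  by_cases hxp : x = p
  · subst hxp
    exact ⟨V, hV, hpV hx, q, by simp [hq]⟩
  · let W : X.Opens := ⟨{p}ᶜ, hp.isOpen_compl⟩
    exact ⟨U ⊓ W, inf_le_left, ⟨hx, hxp⟩, hι.surjective (U ⊓ W) (fun h ↦ h.2 rfl) _⟩

/-- Only a neighbourhood of `p` matters, and there `down` is surjective: lift both sections along
`down`, combine them, and map the result back by `down'`. -/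
lemma LinkCompat.isCodimLEOne_of_lift (l : IsLink I J up down) (hn : IsNodal σ I J) {p : X}
    (hp : p ∉ J.support) (hp' : IsClosed {p}) (hι : IsModification p ι)
    {ι' : Q' ⟶ M'} (H : LinkCompat σ up down up' down' ι ι')
    (h : IsCodimLEOne σ ι') : IsCodimLEOne σ ι := by
  obtain ⟨c, hc, hdown⟩ := H.down
  refine hι.isCodimLEOne hp' fun U s t ↦ ⟨U ⊓ coSupport J, inf_le_left, fun h ↦ ⟨h, hp⟩, ?_⟩
  obtain ⟨s', hs'⟩ := l.down_app_surjective hn inf_le_right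
    (M.res (inf_le_left : U ⊓ coSupport J ≤ U) s)
  obtain ⟨t', ht'⟩ := l.down_app_surjective hn inf_le_right
    (M.res (inf_le_left : U ⊓ coSupport J ≤ U) t)
  obtain ⟨a, b, hab, q, hq⟩ := h (U ⊓ coSupport J) s' t'
  refine ⟨a, b, hab, X.fres (le_top : U ⊓ coSupport J ≤ ⊤) (σ c⁻¹) • down'.app _ q, ?_⟩
  rw [Hom.app_smul, hdown, hq, ← smul_fres_eq_iff hc, map_add, Hom.app_smul, Hom.app_smul, hs', ht']

end AlgebraicGeometry.Scheme.Modules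

/-! ### Finite-dimensionality of spaces of sections. -/

lemma ringKrullDimLE_zero_quotient {B : Type*} [CommRing B] [IsDomain B] (h : ringKrullDim B ≤ 1)
    {a : B} (ha : a ≠ 0) : Ring.KrullDimLE 0 (B ⧸ Ideal.span {a}) := by
  rw [Ring.KrullDimLE, Order.krullDimLE_iff, ← ENat.WithBot.add_le_add_one_right_iff,
    Nat.cast_zero, zero_add]
  exact (ringKrullDim_quotient_succ_le_of_nonZeroDivisor
    (mem_nonZeroDivisors_of_ne_zero ha)).trans h

/-- A space of elements of a field which become integral, with respect to each of finitely many
one-dimensional rings, after multiplication by a nonzero element, is finite-dimensional if the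
elements of the intersection of these rings form a finite-dimensional space. -/
lemma finite_quotient_ker_of_local {k K S ι : Type*} [Field k] [Field K] [Algebra k K]
    [AddCommGroup S] [Module k S] [Finite ι] (B : ι → Type*) [∀ i, CommRing (B i)]
    [∀ i, Algebra k (B i)] (θ : ∀ i, B i →ₐ[k] K) (hθ : ∀ i, Function.Injective (θ i))
    (hB : ∀ i, ∀ a : B i, a ≠ 0 → Module.Finite k (B i ⧸ Ideal.span {a}))
    (T : Submodule k K) [Module.Finite k T] (hT : ∀ x, (∀ i, ∃ b, θ i b = x) → x ∈ T)
    (τ : S →ₗ[k] K) (g : ι → K) (hg : ∀ i, g i ≠ 0) (hτ : ∀ i s, ∃ b, θ i b = g i * τ s) :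
    Module.Finite k (S ⧸ LinearMap.ker τ) := by
  by_cases h0 : ∀ s, τ s = 0
  · have : LinearMap.ker τ = ⊤ := by ext; simp [h0]
    rw [this]
    infer_instance
  push Not at h0
  obtain ⟨s₀, hs₀⟩ := h0
  choose β hβ using hτ
  let β' : ∀ i, S →ₗ[k] B i := fun i ↦
    { toFun := β i
      map_add' := fun s t ↦ hθ i (by simp [hβ, mul_add])
      map_smul' := fun c s ↦ hθ i (by simp [hβ]) }
  have hβ' : ∀ i s, θ i (β' i s) = g i * τ s := hβ
  have hne : ∀ i, β' i s₀ ≠ 0 := fun i h ↦ by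
    have := hβ' i s₀
    rw [h, map_zero] at this
    exact mul_ne_zero (hg i) hs₀ this.symm
  have := fun i ↦ hB i _ (hne i)
  -- The divisor of zeros of `s₀` is finite, so `Φ` has finite-dimensional target. On its kernel the
  -- quotient `τ s / τ s₀` is regular in every chart and hence lies in `T`.
  let Φ : S →ₗ[k] (∀ i, B i ⧸ Ideal.span {β' i s₀}) :=
    LinearMap.pi fun i ↦ (Ideal.Quotient.mkₐ k (Ideal.span {β' i s₀})).toLinearMap ∘ₗ β' i
  let ψ : S →ₗ[k] K := (LinearMap.mulLeft k (τ s₀)⁻¹) ∘ₗ τ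
  have hψ : ∀ s, ψ s = (τ s₀)⁻¹ * τ s := fun _ ↦ rfl
  have hker : LinearMap.ker ψ = LinearMap.ker τ := by
    ext s
    simp [hψ, hs₀]
  have hΦ : ∀ s ∈ LinearMap.ker Φ, ψ s ∈ T := fun s hs ↦ hT _ fun i ↦ by
    have h1 : Ideal.Quotient.mk (Ideal.span {β' i s₀}) (β' i s) = 0 := congr_fun hs i
    obtain ⟨b, hb⟩ := Ideal.mem_span_singleton'.mp (Ideal.Quotient.eq_zero_iff_mem.mp h1)
    refine ⟨b, ?_⟩
    have h2 := congr_arg (θ i) hb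
    rw [map_mul, hβ', hβ'] at h2
    rw [hψ, eq_inv_mul_iff_mul_eq₀ hs₀]
    exact mul_left_cancel₀ (hg i) (by linear_combination h2)
  have h2 : Module.Finite k ((LinearMap.ker Φ).map ψ) :=
    Module.Finite.of_injective (Submodule.inclusion (show (LinearMap.ker Φ).map ψ ≤ T by
      rintro _ ⟨s, hs, rfl⟩
      exact hΦ s hs)) (Submodule.inclusion_injective _)
  rw [← hker]
  -- The range of `ψ` is an extension of a quotient of `S ⧸ ker Φ` by the image of `ker Φ`, which
  -- lies in `T`.
  have h3 : Module.Finite k (LinearMap.range ψ) := by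
    have : Module.Finite k (LinearMap.range ψ ⧸ ((LinearMap.ker Φ).map ψ.rangeRestrict)) := by
      let e : S →ₗ[k] (LinearMap.range ψ ⧸ ((LinearMap.ker Φ).map ψ.rangeRestrict)) :=
        (Submodule.mkQ _) ∘ₗ ψ.rangeRestrict
      have he : Function.Surjective e :=
        (Submodule.mkQ_surjective _).comp ψ.surjective_rangeRestrict
      have hle : LinearMap.ker Φ ≤ LinearMap.ker e := fun s hs ↦ by
        simpa [e] using ⟨s, hs, rfl⟩
      have : Module.Finite k (S ⧸ LinearMap.ker Φ) := .equiv Φ.quotKerEquivRange.symm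
      refine Module.Finite.of_surjective ((LinearMap.ker Φ).liftQ e hle) ?_
      rw [← LinearMap.range_eq_top, Submodule.range_liftQ, LinearMap.range_eq_top]
      exact he
    have : Module.Finite k ((LinearMap.ker Φ).map ψ.rangeRestrict) := by
      refine Module.Finite.of_injective
        (((LinearMap.range ψ).subtype.restrict (p := (LinearMap.ker Φ).map ψ.rangeRestrict)
          (q := (LinearMap.ker Φ).map ψ) ?_)) ?_
      · rintro _ ⟨s, hs, rfl⟩
        exact ⟨s, hs, rfl⟩
      · intro x y h
        have h' := congr_arg Subtype.val h
        exact Subtype.ext (Subtype.ext h')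
    exact .of_submodule_quotient ((LinearMap.ker Φ).map ψ.rangeRestrict)
  exact .equiv ψ.quotKerEquivRange.symm

namespace AlgebraicGeometry.Scheme

/-- The homomorphism from the base field to the functions over an open of a `k`-scheme. -/
noncomputable def baseHom {k : Type u} [Field k] {Y : Scheme.{u}} (g : Y ⟶ Spec (.of k))
    (U : Y.Opens) : k →+* Γ(Y, U) :=
  (Y.fres le_top).comp (g.appTop.hom.comp (Scheme.ΓSpecIso (.of k)).inv.hom)

lemma fres_baseHom {k : Type u} [Field k] {Y : Scheme.{u}} (g : Y ⟶ Spec (.of k))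
    {U V : Y.Opens} (h : V ≤ U) (c : k) : Y.fres h (baseHom g U c) = baseHom g V c :=
  fres_fres _ _ _

/-- Dividing the one-dimensional domain by `a ≠ 0` leaves a finite type `k`-algebra of dimension
zero, which is finite over `k`. -/
lemma finite_quotient_of_dim_le_one {k : Type u} [Field k] {Y : Scheme.{u}}
    (g : Y ⟶ Spec (.of k)) [IsIntegral Y] [LocallyOfFiniteType g]
    (hdim : topologicalKrullDim Y ≤ 1) {U : Y.Opens} (hU : IsAffineOpen U) [Nonempty U]
    {a : Γ(Y, U)} (ha : a ≠ 0) :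
    letI := (baseHom g U).toAlgebra
    Module.Finite k (Γ(Y, U) ⧸ Ideal.span {a}) := by
  let := (baseHom g U).toAlgebra
  have h1 : ringKrullDim Γ(Y, U) ≤ 1 := by
    rw [← PrimeSpectrum.topologicalKrullDim_eq_ringKrullDim]
    exact hU.fromSpec.isOpenEmbedding.isInducing.topologicalKrullDim_le.trans hdim
  have h2 : Algebra.FiniteType k Γ(Y, U) := by
    have h3 := g.finiteType_appLE (isAffineOpen_top _) hU le_top
    have h4 : ((Scheme.ΓSpecIso (.of k)).inv.hom).FiniteType :=
      RingHom.FiniteType.of_surjective _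
        (ConcreteCategory.bijective_of_isIso (Scheme.ΓSpecIso (.of k)).inv).2
    exact h3.comp h4
  have h5 := ringKrullDimLE_zero_quotient h1 ha
  have h6 : Algebra.FiniteType k (Γ(Y, U) ⧸ Ideal.span {a}) := inferInstance
  exact (Module.finite_iff_krullDimLE_zero k _).mpr h5

lemma exists_germ_eq_of_cover {Y : Scheme.{u}} [IsIntegral Y] {ι : Type*} (U : ι → Y.Opens)
    (hU : ∀ y, ∃ i, y ∈ U i) (hη : ∀ i, genericPoint Y ∈ U i) (x : Y.functionField)
    (hx : ∀ i, ∃ b, Y.presheaf.germ (U i) _ (hη i) b = x) :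
    ∃ b, Y.presheaf.germ ⊤ (genericPoint Y) trivial b = x := by
  choose b hb using hx
  obtain ⟨i₀, -⟩ := hU (genericPoint Y)
  obtain ⟨s, hs, -⟩ := TopCat.Sheaf.existsUnique_gluing' Y.sheaf U ⊤ (fun i ↦ homOfLE le_top)
    (fun y _ ↦ TopologicalSpace.Opens.mem_iSup.mpr (hU y)) b (fun i j ↦ by
      refine germ_injective_of_isIntegral Y (U := U i ⊓ U j) (genericPoint Y) ⟨hη i, hη j⟩ ?_
      refine (TopCat.Presheaf.germ_res_apply Y.presheaf _ _ _ _).trans ?_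
      refine Eq.trans ?_ (TopCat.Presheaf.germ_res_apply Y.presheaf _ _ _ _).symm
      exact (hb i).trans (hb j).symm)
  refine ⟨s, ?_⟩
  rw [← hb i₀, ← hs i₀]
  exact (TopCat.Presheaf.germ_res_apply Y.presheaf (homOfLE le_top) _ (hη i₀) s).symm

end AlgebraicGeometry.Scheme

namespace AlgebraicGeometry.Scheme

variable {X Y : Scheme.{u}} [IsIntegral Y] (i : Y ⟶ X)

/-- The value of a function at the generic point of the integral scheme `Y` over `X`. -/
noncomputable def genericEval (U : X.Opens) (h : i (genericPoint Y) ∈ U) :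
    Γ(X, U) →+* Y.functionField :=
  (Y.presheaf.germ (i ⁻¹ᵁ U) (genericPoint Y) h).hom.comp (i.app U).hom

lemma genericEval_fres {U V : X.Opens} (hVU : V ≤ U) (h : i (genericPoint Y) ∈ V) (a : Γ(X, U)) :
    genericEval i V h (X.fres hVU a) = genericEval i U (hVU h) a := by
  have h1 := i.germ_stalkMap_apply V (genericPoint Y) h (X.fres hVU a)
  have h2 := i.germ_stalkMap_apply U (genericPoint Y) (hVU h) a
  refine h1.symm.trans (Eq.trans ?_ h2)
  exact congr_arg _ (TopCat.Presheaf.germ_res_apply X.presheaf (homOfLE hVU) _ h a)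

lemma app_eq_zero_of_genericEval {U : X.Opens} {h : i (genericPoint Y) ∈ U} {a : Γ(X, U)}
    (ha : genericEval i U h a = 0) : i.app U a = 0 :=
  germ_injective_of_isIntegral Y (U := i ⁻¹ᵁ U) (genericPoint Y) h (ha.trans (map_zero _).symm)

end AlgebraicGeometry.Scheme

open AlgebraicGeometry.Scheme

namespace TwoComponentCurve

variable {k : Type u} [Field k] (C : TwoComponentCurve k)

lemma res_smul_H0 {M : C.X.Modules} (c : k) (s : C.H0 M) (U : C.X.Opens) :
    M.res (le_top : U ≤ ⊤) (c • s) =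
      C.X.fres (le_top : U ≤ ⊤) (C.scalars c) • M.res (le_top : U ≤ ⊤) s :=
  res_smul _ _ _ _

lemma genericEval_scalars {Y : Scheme.{u}} [IsIntegral Y] (i : Y ⟶ C.X) (c : k) :
    genericEval i ⊤ trivial (C.scalars c) =
      Y.presheaf.germ ⊤ (genericPoint Y) trivial (baseHom (i ≫ C.f) ⊤ c) := by
  simp only [genericEval, baseHom, scalars, RingHom.comp_apply, fres_self, Scheme.Hom.comp_appTop,
    CommRingCat.hom_comp]
  rfl

/-- Up to a finite-dimensional space, the sections of a line bundle vanish on a given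
one-dimensional integral closed subscheme. -/
lemma exists_finite_quotient {Y : Scheme.{u}} (i : Y ⟶ C.X) [IsIntegral Y] [IsClosedImmersion i]
    (hdim : topologicalKrullDim Y ≤ 1) {L : C.X.Modules} (hL : L.IsLineBundle) :
    ∃ T : Submodule k (C.H0 L), Module.Finite k (C.H0 L ⧸ T) ∧
      ∀ s ∈ T, ∀ (U : C.X.affineOpens) (e : Γ(L, U.1)), L.IsGenerator e → ∀ a : Γ(C.X, U.1),
        a • e = L.res (le_top : U.1 ≤ ⊤) s → a ∈ (Scheme.Hom.ker i).ideal U := by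
  have := C.isProper
  have : IsProper (i ≫ C.f) := inferInstance
  have : CompactSpace C.X := (quasiCompact_iff_compactSpace C.f).mp inferInstance
  let η := genericPoint Y
  let : ∀ U, Algebra k Γ(Y, U) := fun U ↦ (baseHom (i ≫ C.f) U).toAlgebra
  let : Algebra k Y.functionField :=
    ((Y.presheaf.germ ⊤ η trivial).hom.comp (baseHom (i ≫ C.f) ⊤)).toAlgebra
  have hgerm : ∀ (U : Y.Opens) (h : η ∈ U) (c : k),
      Y.presheaf.germ U η h (baseHom (i ≫ C.f) U c) = algebraMap k Y.functionField c := by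
    intro U h c
    rw [← fres_baseHom (i ≫ C.f) le_top c]
    exact TopCat.Presheaf.germ_res_apply Y.presheaf (homOfLE le_top) η h _
  have hscal : ∀ (U : C.X.Opens) (h : i η ∈ U) (c : k),
      genericEval i U h (C.X.fres le_top (C.scalars c)) = algebraMap k Y.functionField c := by
    intro U h c
    rw [genericEval_fres, C.genericEval_scalars]
    rfl
  obtain ⟨U₀, h₀, -, e₀, he₀⟩ := hL.exists_generator (U := ⊤) (x := i η) trivial
  have hcoord : ∀ s : C.H0 L, ∃ a : Γ(C.X, U₀.1), a • e₀ = L.res (le_top : U₀.1 ≤ ⊤) s :=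
    fun s ↦ he₀.bijective.2 _
  choose α hα using hcoord
  have hαu : ∀ (s : C.H0 L) a, a • e₀ = L.res (le_top : U₀.1 ≤ ⊤) s → α s = a := fun s a h ↦
    he₀.bijective.1 ((hα s).trans h.symm)
  -- A trivialisation near the generic point of `Y` turns sections into rational functions on `Y`;
  -- by `hchange`, any other trivialisation changes them by a fixed nonzero factor.
  let τ : C.H0 L →ₗ[k] Y.functionField :=
    { toFun := fun s ↦ genericEval i U₀.1 h₀ (α s)
      map_add' := fun s t ↦ by
        rw [← map_add, hαu (s + t) (α s + α t) ((add_smul _ _ _).trans (by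
          rw [hα, hα]; exact (map_add _ _ _).symm))]
      map_smul' := fun c s ↦ by
        rw [hαu (c • s) (C.X.fres le_top (C.scalars c) * α s)
          (by rw [mul_smul, hα, C.res_smul_H0]), map_mul, hscal, RingHom.id_apply,
          Algebra.smul_def] }
  have hτ : ∀ s, τ s = genericEval i U₀.1 h₀ (α s) := fun _ ↦ rfl
  have hchange : ∀ (U : C.X.Opens) (e : Γ(L, U)), L.IsGenerator e → ∀ h : i η ∈ U,
      ∃ g : Y.functionField, g ≠ 0 ∧ ∀ (s : C.H0 L) (a : Γ(C.X, U)),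
        a • e = L.res (le_top : U ≤ ⊤) s → genericEval i U h a = g * τ s := by
    intro U e he h
    have hle : U₀.1 ⊓ U ≤ U₀.1 := inf_le_left
    have hle' : U₀.1 ⊓ U ≤ U := inf_le_right
    have hW : i η ∈ U₀.1 ⊓ U := ⟨h₀, h⟩
    obtain ⟨g, hg : g • _ = _⟩ := (he _ hle').2 (L.res hle e₀)
    obtain ⟨g', hg' : g' • _ = _⟩ := (he₀ _ hle).2 (L.res hle' e)
    have hgg : g' * g = 1 := (he _ hle').1 (by
      dsimp only
      rw [mul_smul, hg, hg', one_smul])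
    refine ⟨genericEval i (U₀.1 ⊓ U) hW g, ?_, fun s a ha ↦ ?_⟩
    · have := congr_arg (genericEval i (U₀.1 ⊓ U) hW) hgg
      rw [map_mul, map_one] at this
      exact right_ne_zero_of_mul_eq_one this
    · have h1 : C.X.fres hle' a = g * C.X.fres hle (α s) := (he _ hle').1 (by
        dsimp only
        rw [mul_comm, mul_smul, hg, ← res_smul, ← res_smul, ha, hα]
        exact (res_res _ _ _ _).trans (res_res _ _ _ _).symm)
      rw [hτ, ← genericEval_fres i hle' hW, h1, map_mul, genericEval_fres i hle]
  refine ⟨LinearMap.ker τ, ?_, fun s hs U e he a ha ↦ ?_⟩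
  · have hloc : ∀ x : C.X, ∃ U : C.X.affineOpens, x ∈ U.1 ∧ ∃ e : Γ(L, U.1), L.IsGenerator e := by
      intro x
      obtain ⟨U, hx, -, he⟩ := hL.exists_generator (U := ⊤) (x := x) trivial
      exact ⟨U, hx, he⟩
    choose U hU e he using hloc
    obtain ⟨t, ht⟩ := isCompact_univ.elim_finite_subcover (fun x ↦ ((U x).1 : Set C.X))
      (fun x ↦ (U x).1.isOpen) (fun x _ ↦ Set.mem_iUnion.mpr ⟨x, hU x⟩)
    -- Keep only the charts containing the generic point: by irreducibility of `Y` these are exactly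
    -- the ones that meet `Y`.
    let ι := {x : t // i η ∈ (U x.1).1}
    have hcov : ∀ y : Y, ∃ j : ι, y ∈ i ⁻¹ᵁ (U j.1.1).1 := by
      intro y
      obtain ⟨x, hx, hy⟩ := Set.mem_iUnion₂.mp (ht (Set.mem_univ (i y)))
      refine ⟨⟨⟨x, hx⟩, ?_⟩, hy⟩
      exact ((genericPoint_spec Y).mem_open_set_iff (i ⁻¹ᵁ (U x).1).isOpen).mpr
        ⟨y, Set.mem_univ _, hy⟩
    choose g hg0 hg using fun j : ι ↦ hchange _ _ (he j.1.1) j.2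
    have hfin : Module.Finite k Γ(Y, ⊤) := by
      have h1 := finite_appTop_of_universallyClosed k (i ≫ C.f)
      have h2 : ((Scheme.ΓSpecIso (.of k)).inv.hom).Finite :=
        RingHom.Finite.of_surjective _
          (ConcreteCategory.bijective_of_isIso (Scheme.ΓSpecIso (.of k)).inv).2
      have h3 : (baseHom (i ≫ C.f) ⊤).Finite := by
        have : baseHom (i ≫ C.f) ⊤ =
            (i ≫ C.f).appTop.hom.comp (Scheme.ΓSpecIso (.of k)).inv.hom := by
          ext c
          exact fres_self _ _
        rw [this]
        exact h1.comp h2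
      exact h3
    let γ : Γ(Y, ⊤) →ₗ[k] Y.functionField :=
      { toFun := fun b ↦ Y.presheaf.germ ⊤ η trivial b
        map_add' := map_add _
        map_smul' := fun c b ↦ by
          rw [Algebra.smul_def, Algebra.smul_def, map_mul]
          rfl }
    refine finite_quotient_ker_of_local (ι := ι) (fun j ↦ Γ(Y, i ⁻¹ᵁ (U j.1.1).1))
      (fun j ↦ { (Y.presheaf.germ (i ⁻¹ᵁ (U j.1.1).1) η j.2).hom with
        commutes' := hgerm _ j.2 })
      (fun j ↦ germ_injective_of_isIntegral Y η j.2)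
      (fun j a ha ↦ ?_) (LinearMap.range γ)
      (fun x hx ↦ exists_germ_eq_of_cover _ hcov (fun j ↦ j.2) x hx)
      τ g hg0 (fun j s ↦ ?_)
    · have : Nonempty (i ⁻¹ᵁ (U j.1.1).1) := ⟨⟨η, j.2⟩⟩
      exact finite_quotient_of_dim_le_one (i ≫ C.f) hdim ((U j.1.1).2.preimage i) ha
    · obtain ⟨a, ha⟩ := (he j.1.1).bijective.2 (L.res (le_top : (U j.1.1).1 ≤ ⊤) s)
      exact ⟨i.app _ a, hg j s a ha⟩
  · rw [Scheme.Hom.ker_apply]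
    change i.app U.1 a = 0
    by_cases h : i η ∈ U.1
    · obtain ⟨g, -, hg⟩ := hchange U.1 e he h
      refine app_eq_zero_of_genericEval i (h := h) ?_
      rw [hg s a ha, LinearMap.mem_ker.mp hs, mul_zero]
    · have : i ⁻¹ᵁ U.1 = ⊥ := by
        by_contra hne
        obtain ⟨y, hy⟩ := (TopologicalSpace.Opens.ne_bot_iff_nonempty _).mp hne
        exact h (((genericPoint_spec Y).mem_open_set_iff (i ⁻¹ᵁ U.1).isOpen).mpr
          ⟨y, Set.mem_univ _, hy⟩)
      have : Subsingleton Γ(Y, i ⁻¹ᵁ U.1) := by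
        rw [this]
        infer_instance
      exact Subsingleton.elim _ _

end TwoComponentCurve

/-! ### Rational points and their ideals. -/

namespace AlgebraicGeometry.Scheme

variable {k : Type u} [Field k] {X : Scheme.{u}} (P : Spec (.of k) ⟶ X)

/-- The point of `X` underlying a `k`-valued point. -/
noncomputable def pt : X := P (IsLocalRing.closedPoint k)

instance : Subsingleton (Spec (.of k)) := inferInstanceAs (Subsingleton (PrimeSpectrum k))

lemma apply_eq_pt (x : Spec (.of k)) : P x = pt P :=
  congr_arg P (Subsingleton.elim _ _)

lemma range_eq_pt : Set.range P = {pt P} := by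
  ext x
  constructor
  · rintro ⟨y, rfl⟩
    exact apply_eq_pt P y
  · rintro rfl
    exact ⟨_, rfl⟩

lemma exists_eq_specMap {U : X.Opens} (hU : IsAffineOpen U) (hP : pt P ∈ U) :
    ∃ φ : Γ(X, U) →+* k, P = Spec.map (CommRingCat.ofHom φ) ≫ hU.fromSpec := by
  have h : Set.range P ⊆ Set.range hU.fromSpec := by
    rw [hU.range_fromSpec, range_eq_pt]
    simpa using hP
  refine ⟨(Spec.preimage (IsOpenImmersion.lift hU.fromSpec P h)).hom, ?_⟩
  rw [CommRingCat.ofHom_hom, Spec.map_preimage, IsOpenImmersion.lift_fac]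

variable {P}

lemma pt_mem_basicOpen_iff {U : X.Opens} {hU : IsAffineOpen U} {φ : Γ(X, U) →+* k}
    (h : P = Spec.map (CommRingCat.ofHom φ) ≫ hU.fromSpec) (a : Γ(X, U)) :
    pt P ∈ X.basicOpen a ↔ φ a ≠ 0 := by
  have h1 : pt P = hU.fromSpec (Spec.map (CommRingCat.ofHom φ) (IsLocalRing.closedPoint k)) := by
    rw [pt, h]
    rfl
  have h2 := hU.fromSpec_preimage_basicOpen a
  rw [h1]
  change Spec.map (CommRingCat.ofHom φ) (IsLocalRing.closedPoint k) ∈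
    hU.fromSpec ⁻¹ᵁ X.basicOpen a ↔ _
  rw [h2]
  change φ a ∉ IsLocalRing.maximalIdeal k ↔ _
  rw [IsLocalRing.maximalIdeal_eq_bot, Ideal.mem_bot]

variable {f : X ⟶ Spec (.of k)}

lemma apply_fres_eq (hP : P ≫ f = 𝟙 _) {U : X.Opens} {hU : IsAffineOpen U} {φ : Γ(X, U) →+* k}
    (h : P = Spec.map (CommRingCat.ofHom φ) ≫ hU.fromSpec) (c : k) :
    φ (baseHom f U c) = c := by
  have h1 : hU.fromSpec ≫ f = Spec.map (CommRingCat.ofHom (baseHom f U)) := by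
    rw [← cancel_mono (Spec (.of k)).toSpecΓ, Category.assoc, toSpecΓ_naturality,
      hU.fromSpec_toSpecΓ_assoc, ← SpecMap_ΓSpecIso_hom, ← Spec.map_comp, ← Spec.map_comp]
    congr 1
    ext c
    change _ = X.fres le_top (f.appTop
      ((Scheme.ΓSpecIso (.of k)).inv ((Scheme.ΓSpecIso (.of k)).hom c)))
    simp [fres]
  rw [h, Category.assoc, h1, ← Spec.map_comp, ← Spec.map_id] at hP
  exact congr($(Spec.map_injective hP) c)

/-- For a rational point, the value of `a` is the only constant `c` for which `a - c` is not
invertible there. So the underlying point determines all values. -/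
lemma eq_of_pt_eq {Q : Spec (.of k) ⟶ X} (hP : P ≫ f = 𝟙 _) (hQ : Q ≫ f = 𝟙 _)
    (h : pt P = pt Q) : P = Q := by
  obtain ⟨U, hPU, -⟩ := exists_affine_le (U := (⊤ : X.Opens)) (x := pt P) trivial
  obtain ⟨φ, hφ⟩ := exists_eq_specMap P U.2 hPU
  obtain ⟨ψ, hψ⟩ := exists_eq_specMap Q U.2 (h ▸ hPU)
  suffices φ = ψ by rw [hφ, hψ, this]
  ext a
  have h0 : φ (a - baseHom f U.1 (φ a)) = 0 := by
    rw [map_sub, apply_fres_eq hP hφ, sub_self]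
  have h1 := (pt_mem_basicOpen_iff hφ (a - baseHom f U.1 (φ a))).not_left.mpr h0
  rw [h] at h1
  have h2 := (pt_mem_basicOpen_iff hψ (a - baseHom f U.1 (φ a))).not_left.mp h1
  rw [map_sub, apply_fres_eq hQ hψ, sub_eq_zero] at h2
  exact h2.symm

lemma isClosedImmersion_of_section [IsSeparated f] (hP : P ≫ f = 𝟙 _) : IsClosedImmersion P :=
  isClosedImmersion_of_comp_eq_id f P hP

lemma isClosed_pt [IsSeparated f] (hP : P ≫ f = 𝟙 _) : IsClosed {pt P} := by
  have := isClosedImmersion_of_section hP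
  rw [← range_eq_pt]
  exact P.isClosedEmbedding.isClosed_range

lemma mem_ker_of_apply_eq_zero [QuasiCompact P] {U : X.affineOpens} {φ : Γ(X, U.1) →+* k}
    (h : P = Spec.map (CommRingCat.ofHom φ) ≫ U.2.fromSpec) {a : Γ(X, U.1)} (ha : φ a = 0) :
    a ∈ (Scheme.Hom.ker P).ideal U := by
  rw [Scheme.Hom.ker_apply]
  change P.app U.1 a = 0
  rw [← AlgebraicGeometry.basicOpen_eq_bot_iff, ← Scheme.preimage_basicOpen, eq_bot_iff]
  intro x hx
  have hx : P x ∈ X.basicOpen a := hx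
  rw [apply_eq_pt, pt_mem_basicOpen_iff h] at hx
  exact (hx ha).elim

/-- The lift of a morphism from an affine scheme to a closed subscheme. -/
lemma exists_lift_of_ker_le {Y : Scheme.{u}} (i : Y ⟶ X) [IsClosedImmersion i] (U : X.affineOpens)
    {A : CommRingCat.{u}} (q : Γ(X, U.1) ⟶ A)
    (hq : ∀ a ∈ (Scheme.Hom.ker i).ideal U, q a = 0) :
    ∃ g : Spec A ⟶ Y, g ≫ i = Spec.map q ≫ U.2.fromSpec := by
  have hs := i.app_surjective U.1 U.2
  have hk : RingHom.ker (i.app U.1).hom ≤ RingHom.ker q.hom := fun a ha ↦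
    hq a (by rw [Scheme.Hom.ker_apply]; exact ha)
  let r := RingHom.liftOfRightInverse (i.app U.1).hom _ (Function.rightInverse_surjInv hs)
    ⟨q.hom, hk⟩
  have hr : i.app U.1 ≫ CommRingCat.ofHom r = q := by
    ext a
    exact RingHom.liftOfRightInverse_comp_apply _ _ (Function.rightInverse_surjInv hs) ⟨q.hom, hk⟩ a
  refine ⟨Spec.map (CommRingCat.ofHom r) ≫ (U.2.preimage i).fromSpec, ?_⟩
  rw [Category.assoc, ← U.2.SpecMap_appLE_fromSpec i (U.2.preimage i) le_rfl, ← Spec.map_comp_assoc,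
    Scheme.Hom.appLE_eq_app, hr]

end AlgebraicGeometry.Scheme

/-! ### The node of the curve, and finiteness of `H⁰`. -/

namespace TwoComponentCurve

variable {k : Type u} [Field k] (C : TwoComponentCurve k)

lemma N_comp_f : C.N ≫ C.f = 𝟙 _ := by
  rw [N, Category.assoc, C.nY_section]

lemma mem_support_idealY {x : C.X} : x ∈ C.idealY.support ↔ x ∈ Set.range C.iY := by
  have := C.isClosedImmersionY
  rw [idealY, ← SetLike.mem_coe, Scheme.Hom.support_ker,
    C.iY.isClosedEmbedding.isClosed_range.closure_eq]

lemma mem_support_idealZ {x : C.X} : x ∈ C.idealZ.support ↔ x ∈ Set.range C.iZ := by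
  have := C.isClosedImmersionZ
  rw [idealZ, ← SetLike.mem_coe, Scheme.Hom.support_ker,
    C.iZ.isClosedEmbedding.isClosed_range.closure_eq]

lemma eq_pt_N {x : C.X} (hY : x ∈ C.idealY.support) (hZ : x ∈ C.idealZ.support) : x = pt C.N := by
  obtain ⟨y, rfl⟩ := C.mem_support_idealY.mp hY
  obtain ⟨z, hz⟩ := C.mem_support_idealZ.mp hZ
  obtain ⟨w, rfl, -⟩ := exists_preimage_of_isPullback C.isPullback y z hz.symm
  exact apply_eq_pt C.N w

lemma idealY_inf_idealZ : C.idealY ⊓ C.idealZ = ⊥ := by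
  have := C.isClosedImmersionY
  have := C.isClosedImmersionZ
  have := C.isReduced
  ext U a
  refine ⟨fun ⟨hY, hZ⟩ ↦ ?_, fun h ↦ ?_⟩
  · suffices C.X.basicOpen a = ⊥ from (AlgebraicGeometry.basicOpen_eq_bot_iff _).mp this
    rw [eq_bot_iff]
    intro x hx
    have hxU : x ∈ U.1 := C.X.basicOpen_le a hx
    rcases C.cover.ge (Set.mem_univ x) with h | h
    · exact (notMem_basicOpen_of_mem_ideal hxU (C.mem_support_idealY.mpr h) hY hx).elim
    · exact (notMem_basicOpen_of_mem_ideal hxU (C.mem_support_idealZ.mpr h) hZ hx).elim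
  · obtain rfl : a = 0 := h
    exact zero_mem _

/-- This is where transversality enters. The closed subscheme of `U` cut out by `I_Y + I_Z` maps to
both components, hence factors through their fibre product `N`; a function vanishing at `N` is
therefore zero on it. -/
lemma mem_sup_of_vanish {U : C.X.affineOpens} {φ : Γ(C.X, U.1) →+* k}
    (h : C.N = Spec.map (CommRingCat.ofHom φ) ≫ U.2.fromSpec) {a : Γ(C.X, U.1)} (ha : φ a = 0) :
    a ∈ C.idealY.ideal U ⊔ C.idealZ.ideal U := by
  have := C.isClosedImmersionY
  have := C.isClosedImmersionZ
  let K := C.idealY.ideal U ⊔ C.idealZ.ideal U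
  let q : Γ(C.X, U.1) ⟶ .of (Γ(C.X, U.1) ⧸ K) := CommRingCat.ofHom (Ideal.Quotient.mk K)
  obtain ⟨gY, hgY⟩ := exists_lift_of_ker_le C.iY U q fun b hb ↦
    Ideal.Quotient.eq_zero_iff_mem.mpr (le_sup_left (a := C.idealY.ideal U) hb)
  obtain ⟨gZ, hgZ⟩ := exists_lift_of_ker_le C.iZ U q fun b hb ↦
    Ideal.Quotient.eq_zero_iff_mem.mpr (le_sup_right (b := C.idealZ.ideal U) hb)
  let l := C.isPullback.lift gY gZ (hgY.trans hgZ.symm)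
  have hl : l ≫ C.N = Spec.map q ≫ U.2.fromSpec := by
    rw [N, C.isPullback.lift_fst_assoc, hgY]
  rw [h, ← Spec.map_preimage l, ← Category.assoc, ← Spec.map_comp] at hl
  have hU : IsAffineOpen U.1 := U.2
  have hl' := (cancel_mono hU.fromSpec).mp hl
  have hq : q a = (Spec.preimage l) (φ a) := congr($(Spec.map_injective hl') a).symm
  rw [ha, map_zero] at hq
  exact Ideal.Quotient.eq_zero_iff_mem.mp hq

lemma isNodal : IsNodal C.scalars C.idealY C.idealZ where
  inf_eq_bot := C.idealY_inf_idealZ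
  subsingleton x y hx hx' hy hy' := (C.eq_pt_N hx hx').trans (C.eq_pt_N hy hy').symm
  exists_const U x hx hY hZ a ha := by
    obtain rfl := C.eq_pt_N hY hZ
    obtain ⟨φ, hφ⟩ := exists_eq_specMap C.N U.2 hx
    refine ⟨φ a, (pt_mem_basicOpen_iff hφ a).mp ha,
      C.mem_sup_of_vanish hφ ?_⟩
    rw [map_sub, sub_eq_zero]
    exact (apply_fres_eq C.N_comp_f hφ (φ a)).symm

/-- A section in both finite-codimensional subspaces has local coordinates in `I_Y ∩ I_Z = 0`. -/
lemma finite_H0 {L : C.X.Modules} (hL : L.IsLineBundle) : Module.Finite k (C.H0 L) := by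
  have := C.isClosedImmersionY
  have := C.isClosedImmersionZ
  have := C.isIntegralY
  have := C.isIntegralZ
  obtain ⟨T, hT, hT'⟩ := C.exists_finite_quotient C.iY C.dimY.le hL
  obtain ⟨S, hS, hS'⟩ := C.exists_finite_quotient C.iZ C.dimZ.le hL
  let e : C.H0 L →ₗ[k] (C.H0 L ⧸ T) × (C.H0 L ⧸ S) := T.mkQ.prod S.mkQ
  refine Module.Finite.of_injective e (LinearMap.ker_eq_bot.mp (eq_bot_iff.mpr fun s hs ↦ ?_))
  have hsT : s ∈ T := by simpa [e] using congr_arg Prod.fst hs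
  have hsS : s ∈ S := by simpa [e] using congr_arg Prod.snd hs
  refine eq_zero_of_locally (M := L) (s := s) fun x _ ↦ ?_
  obtain ⟨U, hx, -, g, hg⟩ := hL.exists_generator (U := ⊤) (x := x) trivial
  refine ⟨U.1, le_top, hx, ?_⟩
  obtain ⟨a, ha : a • g = _⟩ := hg.bijective.2 (L.res (le_top : U.1 ≤ ⊤) s)
  have h0 : a ∈ (C.idealY ⊓ C.idealZ).ideal U := ⟨hT' s hsT U g hg a ha, hS' s hsS U g hg a ha⟩
  rw [C.idealY_inf_idealZ] at h0
  obtain rfl : a = 0 := h0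
  rw [← ha, zero_smul]

end TwoComponentCurve

/-! ### Linear algebra of pure families of subspaces. -/

/-- Two-sided recursion on the integers, starting at `b`. -/
lemma exists_int_family {P : ℤ → Type*} (R : ∀ i j, i + 1 = j → P i → P j → Prop) (b : ℤ) (x₀ : P b)
    (hup : ∀ i j h, b ≤ i → ∀ x, ∃ y, R i j h x y)
    (hdown : ∀ i j h, j ≤ b → ∀ y, ∃ x, R i j h x y) :
    ∃ f : ∀ i, P i, f b = x₀ ∧ ∀ i j h, R i j h (f i) (f j) := by
  choose u hu using hup
  choose d hd using hdown
  let f : ∀ i, P i := fun i ↦ Int.inductionOn' i b x₀ (fun i hi x ↦ u i (i + 1) rfl hi x)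
    (fun j hj y ↦ d (j - 1) j (sub_add_cancel j 1) hj y)
  refine ⟨f, Int.inductionOn'_self, fun i j h ↦ ?_⟩
  by_cases hi : b ≤ i
  · subst h
    have : f (i + 1) = u i (i + 1) rfl hi (f i) := Int.inductionOn'_add_one hi
    rw [this]
    exact hu _ _ _ _ _
  · obtain rfl : i = j - 1 := by omega
    have hj : j ≤ b := by omega
    have : f (j - 1) = d (j - 1) j (sub_add_cancel j 1) hj (f j) :=
      Int.inductionOn'_sub_one hj
    rw [this]
    exact hd _ _ _ _ _

section LinearAlgebra

variable {k : Type*} [Field k]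

lemma Submodule.exists_between_finrank_eq {V : Type*} [AddCommGroup V] [Module k V]
    {A B : Submodule k V} (hAB : A ≤ B) [Module.Finite k B] {n : ℕ} (hA : Module.finrank k A ≤ n)
    (hB : n ≤ Module.finrank k B) : ∃ H, A ≤ H ∧ H ≤ B ∧ Module.finrank k H = n := by
  induction n, hA using Nat.le_induction with
  | base => exact ⟨A, le_rfl, hAB, rfl⟩
  | succ m hm ih =>
    obtain ⟨H, hAH, hHB, rfl⟩ := ih (by omega)
    have hlt : H < B := lt_of_le_of_ne hHB (by rintro rfl; omega)
    obtain ⟨x, hxB, hxH⟩ := SetLike.exists_of_lt hlt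
    refine ⟨H ⊔ k ∙ x, hAH.trans le_sup_left, sup_le hHB (by simpa using hxB), ?_⟩
    have : Module.Finite k H := Submodule.finiteDimensional_of_le hHB
    have hle : H ⊔ k ∙ x ≤ B := sup_le hHB (by simpa using hxB)
    have : Module.Finite k ↥(H ⊔ k ∙ x) := Submodule.finiteDimensional_of_le hle
    have h1 := Submodule.finrank_add_le_finrank_add_finrank H (k ∙ x)
    have h2 := finrank_span_le_card (R := k) ({x} : Set V)
    have h3 : Module.finrank k H < Module.finrank k ↥(H ⊔ k ∙ x) :=
      Submodule.finrank_lt_finrank_of_lt (lt_of_le_of_ne le_sup_left fun h ↦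
        hxH (h ▸ (le_sup_right : k ∙ x ≤ H ⊔ k ∙ x) (Submodule.mem_span_singleton_self x)))
    simp at h2
    omega

lemma Submodule.finrank_le_finrank_inf_add_one {V : Type*} [AddCommGroup V] [Module k V]
    (S K : Submodule k V) [Module.Finite k S]
    (h : ∀ x ∈ S, ∀ y ∈ S, ∃ a b : k, (a ≠ 0 ∨ b ≠ 0) ∧ a • x + b • y ∈ K) :
    Module.finrank k S ≤ Module.finrank k ↥(S ⊓ K) + 1 := by
  have : Module.Finite k ↥(S ⊓ K) := Submodule.finiteDimensional_of_le inf_le_left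
  by_cases hSK : S ≤ K
  · rw [inf_eq_left.mpr hSK]
    omega
  obtain ⟨x, hxS, hxK⟩ := SetLike.not_le_iff_exists.mp hSK
  have hle : S ≤ (S ⊓ K) ⊔ k ∙ x := by
    intro y hy
    obtain ⟨a, b, hab, hK⟩ := h y hy x hxS
    have ha : a ≠ 0 := by
      rintro rfl
      have hb : b ≠ 0 := by simpa using hab
      rw [zero_smul, zero_add] at hK
      exact hxK ((Submodule.smul_mem_iff _ hb).mp hK)
    refine Submodule.mem_sup.mpr ⟨a⁻¹ • (a • y + b • x), Submodule.smul_mem _ _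
      ⟨S.add_mem (S.smul_mem _ hy) (S.smul_mem _ hxS), hK⟩, -(a⁻¹ • b • x),
      Submodule.neg_mem _ (Submodule.smul_mem _ _ (Submodule.smul_mem _ _
        (Submodule.mem_span_singleton_self x))), ?_⟩
    rw [smul_add, inv_smul_smul₀ ha, add_neg_cancel_right]
  have h1 := Submodule.finrank_mono hle
  have h2 := Submodule.finrank_add_le_finrank_add_finrank (S ⊓ K) (k ∙ x)
  have h3 := finrank_span_le_card (R := k) ({x} : Set V)
  simp at h3
  omega

lemma Submodule.exists_combination_mem_of_finrank {V : Type*} [AddCommGroup V] [Module k V]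
    {S H : Submodule k V} [Module.Finite k S] (hHS : H ≤ S)
    (h : Module.finrank k S ≤ Module.finrank k H + 1) (x y : V) (hx : x ∈ S) (hy : y ∈ S) :
    ∃ a b : k, (a ≠ 0 ∨ b ≠ 0) ∧ a • x + b • y ∈ H := by
  by_cases hxH : x ∈ H
  · exact ⟨1, 0, by simp, by simpa using hxH⟩
  have hle : H ⊔ k ∙ x ≤ S := sup_le hHS (by simpa using hx)
  have : Module.Finite k ↥(H ⊔ k ∙ x) := Submodule.finiteDimensional_of_le hle
  have h3 : Module.finrank k H < Module.finrank k ↥(H ⊔ k ∙ x) :=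
    Submodule.finrank_lt_finrank_of_lt (lt_of_le_of_ne le_sup_left fun h ↦
      hxH (h ▸ (le_sup_right : k ∙ x ≤ H ⊔ k ∙ x) (Submodule.mem_span_singleton_self x)))
  rw [← Submodule.eq_of_le_of_finrank_le hle (by omega)] at hy
  obtain ⟨z, hz, w, hw, rfl⟩ := Submodule.mem_sup.mp hy
  obtain ⟨c, rfl⟩ := Submodule.mem_span_singleton.mp hw
  exact ⟨-c, 1, by simp, by simpa [add_comm] using hz⟩

variable {V : ℤ → Type*} [∀ i, AddCommGroup (V i)] [∀ i, Module k (V i)]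

/-- In a pure subrepresentation, a subrepresentation of codimension at most one contains a pure one
of codimension at most one, if it contains the images of all maps `up` and the preimages of its
spaces under all maps `down`. -/
theorem exists_pure_of_codim_le_one
    (up : ∀ i j, i + 1 = j → V i →ₗ[k] V j) (down : ∀ i j, i + 1 = j → V j →ₗ[k] V i)
    (hdu : ∀ i j h x, down i j h (up i j h x) = 0) (S K : ∀ i, Submodule k (V i)) {r : ℕ}
    (hS : ∀ i, Module.Finite k (S i) ∧ Module.finrank k (S i) = r)
    (hSu : ∀ i j h, ∀ x ∈ S i, up i j h x ∈ S j) (hSd : ∀ i j h, ∀ x ∈ S j, down i j h x ∈ S i)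
    (hKu : ∀ i j h x, up i j h x ∈ K j) (hKd : ∀ i j h x, down i j h x ∈ K i ↔ x ∈ K j)
    (hK : ∀ i (x y : V i), ∃ a b : k, (a ≠ 0 ∨ b ≠ 0) ∧ a • x + b • y ∈ K i) :
    ∃ W : ∀ i, Submodule k (V i), (∀ i, W i ≤ S i) ∧ (∀ i, W i ≤ K i) ∧
      (∀ i j h, ∀ x ∈ W i, up i j h x ∈ W j) ∧ (∀ i j h, ∀ x ∈ W j, down i j h x ∈ W i) ∧
      ∃ n, r ≤ n + 1 ∧ ∀ i, Module.finrank k (W i) = n := by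
  have := fun i ↦ (hS i).1
  have hSr := fun i ↦ (hS i).2
  -- The indices with `S i ≤ K i` are closed under passing to `i + 1`. Thus either all or none
  -- satisfy it, or there is a last index `b` where it fails.
  have hbad : ∀ i j, i + 1 = j → S i ≤ K i → S j ≤ K j := fun i j h hi x hx ↦
    (hKd i j h x).mp (hi (hSd i j h x hx))
  have hrank : ∀ i, ¬ S i ≤ K i → Module.finrank k ↥(S i ⊓ K i) = r - 1 := fun i hi ↦ by
    have h1 := Submodule.finrank_le_finrank_inf_add_one (S i) (K i) fun x _ y _ ↦ hK i x y
    have h2 := Submodule.finrank_lt_finrank_of_lt (inf_lt_left.mpr hi)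
    rw [hSr] at h1 h2
    omega
  by_cases hall : ∀ i, S i ≤ K i
  · exact ⟨S, fun _ ↦ le_rfl, hall, hSu, hSd, r, by omega, hSr⟩
  by_cases hnone : ∀ i, ¬ S i ≤ K i
  · exact ⟨fun i ↦ S i ⊓ K i, fun _ ↦ inf_le_left, fun _ ↦ inf_le_right,
      fun i j h x hx ↦ ⟨hSu i j h x hx.1, hKu i j h x⟩,
      fun i j h x hx ↦ ⟨hSd i j h x hx.1, (hKd i j h x).mpr hx.2⟩,
      r - 1, by omega, fun i ↦ hrank i (hnone i)⟩
  obtain ⟨b, hb, hb'⟩ : ∃ b, ¬ S b ≤ K b ∧ S (b + 1) ≤ K (b + 1) := by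
    by_contra! hcon
    obtain ⟨i₀, hi₀⟩ := not_forall.mp hall
    refine hnone fun i ↦ ?_
    induction i using Int.inductionOn' (b := i₀) with
    | zero => exact hi₀
    | succ i _ hi => exact hcon i hi
    | pred i _ hi => exact fun h ↦ hi (hbad _ _ (sub_add_cancel i 1) h)
  have hlow : ∀ i ≤ b, ¬ S i ≤ K i := by
    intro i hi
    induction i, hi using Int.leInductionDown with
    | base => exact hb
    | pred i _ hi => exact fun h ↦ hi (hbad _ _ (sub_add_cancel i 1) h)
  have hhigh : ∀ i, b + 1 ≤ i → S i ≤ K i := by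
    intro i hi
    induction i, hi using Int.leInduction with
    | base => exact hb'
    | succ i _ hi => exact hbad _ _ rfl hi
  -- Up to `b` the hyperplane is forced to be `S i ⊓ K i`. Beyond `b`, where `S j ≤ K j`, a subspace
  -- of dimension `r - 1` is chosen between `up H` and `S j ⊓ down⁻¹ H`. These are nested because
  -- `down ∘ up = 0`, and the larger one has codimension at most one in `S j`.
  obtain ⟨f, -, hf⟩ := exists_int_family
    (P := fun i ↦ {H : Submodule k (V i) // H ≤ S i ∧ H ≤ K i ∧ Module.finrank k H = r - 1 ∧
      (i ≤ b → H = S i ⊓ K i)})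
    (fun i j h H H' ↦ (∀ x ∈ H.1, up i j h x ∈ H'.1) ∧ ∀ x ∈ H'.1, down i j h x ∈ H.1) b
    ⟨S b ⊓ K b, inf_le_left, inf_le_right, hrank b hb, fun _ ↦ rfl⟩
    (fun i j h hi ⟨H, hHS, hHK, hH, _⟩ ↦ by
      have hj := hhigh j (by omega)
      let B := S j ⊓ H.comap (down i j h)
      have hAB : H.map (up i j h) ≤ B := by
        rintro _ ⟨x, hx, rfl⟩
        refine ⟨hSu i j h x (hHS hx), ?_⟩
        change down i j h (up i j h x) ∈ H
        rw [hdu]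
        exact zero_mem _
      have : Module.Finite k B := Submodule.finiteDimensional_of_le inf_le_left
      have : Module.Finite k H := Submodule.finiteDimensional_of_le hHS
      have hB : Module.finrank k (S j) ≤ Module.finrank k B + 1 :=
        Submodule.finrank_le_finrank_inf_add_one (S j) (H.comap (down i j h))
        fun x hx y hy ↦ by
          obtain ⟨a, b, hab, hm⟩ := Submodule.exists_combination_mem_of_finrank hHS
            (by rw [hSr, hH]; omega) _ _ (hSd i j h x hx) (hSd i j h y hy)
          exact ⟨a, b, hab, by simpa using hm⟩
      obtain ⟨H', hA, hH'B, hH'⟩ := Submodule.exists_between_finrank_eq hAB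
        ((Submodule.finrank_map_le _ _).trans hH.le) (by rw [hSr] at hB; omega)
      exact ⟨⟨H', hH'B.trans inf_le_left, (hH'B.trans inf_le_left).trans hj, hH',
        fun hjb ↦ by omega⟩, fun x hx ↦ hA ⟨x, hx, rfl⟩, fun x hx ↦ (hH'B hx).2⟩)
    (fun i j h hj ⟨H, hHS, hHK, hH, hHb⟩ ↦
      ⟨⟨S i ⊓ K i, inf_le_left, inf_le_right, hrank i (hlow i (by omega)), fun _ ↦ rfl⟩, by
        obtain rfl := hHb hj
        exact ⟨fun x hx ↦ ⟨hSu i j h x hx.1, hKu i j h x⟩,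
          fun x hx ↦ ⟨hSd i j h x hx.1, (hKd i j h x).mpr hx.2⟩⟩⟩)
  exact ⟨fun i ↦ (f i).1, fun i ↦ (f i).2.1, fun i ↦ (f i).2.2.1, fun i j h ↦ (hf i j h).1,
    fun i j h ↦ (hf i j h).2, r - 1, by omega, fun i ↦ (f i).2.2.2.1⟩

/-- The mirror image of `exists_pure_of_codim_le_one`. -/
theorem exists_pure_of_codim_le_one'
    (up : ∀ i j, i + 1 = j → V i →ₗ[k] V j) (down : ∀ i j, i + 1 = j → V j →ₗ[k] V i)
    (hud : ∀ i j h x, up i j h (down i j h x) = 0) (S K : ∀ i, Submodule k (V i)) {r : ℕ}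
    (hS : ∀ i, Module.Finite k (S i) ∧ Module.finrank k (S i) = r)
    (hSu : ∀ i j h, ∀ x ∈ S i, up i j h x ∈ S j) (hSd : ∀ i j h, ∀ x ∈ S j, down i j h x ∈ S i)
    (hKd : ∀ i j h x, down i j h x ∈ K i) (hKu : ∀ i j h x, up i j h x ∈ K j ↔ x ∈ K i)
    (hK : ∀ i (x y : V i), ∃ a b : k, (a ≠ 0 ∨ b ≠ 0) ∧ a • x + b • y ∈ K i) :
    ∃ W : ∀ i, Submodule k (V i), (∀ i, W i ≤ S i) ∧ (∀ i, W i ≤ K i) ∧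
      (∀ i j h, ∀ x ∈ W i, up i j h x ∈ W j) ∧ (∀ i j h, ∀ x ∈ W j, down i j h x ∈ W i) ∧
      ∃ n, r ≤ n + 1 ∧ ∀ i, Module.finrank k (W i) = n := by
  -- Reindexing by `i ↦ -i` exchanges the roles of `up` and `down`; the result is then transported
  -- back along `- -i = i`.
  obtain ⟨W', hWS, hWK, hWu, hWd, n, hn, hW⟩ := exists_pure_of_codim_le_one
    (V := fun i ↦ V (-i)) (fun i j h ↦ down (-j) (-i) (by omega))
    (fun i j h ↦ up (-j) (-i) (by omega)) (fun i j h x ↦ hud _ _ _ x)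
    (fun i ↦ S (-i)) (fun i ↦ K (-i)) (fun i ↦ hS _) (fun i j h ↦ hSd _ _ _)
    (fun i j h ↦ hSu _ _ _) (fun i j h x ↦ hKd _ _ _ x) (fun i j h x ↦ hKu _ _ _ x)
    (fun i x y ↦ hK _ x y)
  obtain ⟨W, hWW⟩ : ∃ W : ∀ i, Submodule k (V i), ∀ i, W (-i) = W' i := by
    have aux : ∀ i j (_ : j = i) (h : -j = -i),
        Eq.rec (motive := fun l _ ↦ Submodule k (V l)) (W' j) h = W' i := by
      intro i j h h'
      subst h
      rfl
    exact ⟨fun i ↦ Eq.rec (motive := fun l _ ↦ Submodule k (V l)) (W' (-i)) (neg_neg i),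
      fun i ↦ aux i (- -i) (neg_neg i) (neg_neg (-i))⟩
  have hneg : ∀ i : ℤ, ∃ j, i = -j := fun i ↦ ⟨-i, (neg_neg i).symm⟩
  refine ⟨W, fun i ↦ ?_, fun i ↦ ?_, fun i j h ↦ ?_, fun i j h ↦ ?_, n, hn, fun i ↦ ?_⟩ <;>
    obtain ⟨i, rfl⟩ := hneg i
  · exact hWW i ▸ hWS i
  · exact hWW i ▸ hWK i
  · obtain ⟨j, rfl⟩ := hneg j
    rw [hWW, hWW]
    exact hWd j i (by omega)
  · obtain ⟨j, rfl⟩ := hneg j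
    rw [hWW, hWW]
    exact hWu j i (by omega)
  · rw [hWW]
    exact hW i

end LinearAlgebra

/-! ### Embeddings of representations and their pure dimensions. -/

namespace ZRep

variable {k : Type u} [Field k] (R : ZRep k)

/-- The map of the arrow `i → j`, for `j = i + 1`. -/
def upTo (i j : ℤ) (h : i + 1 = j) : R.V i →ₗ[k] R.V j := by
  subst h
  exact R.up i

/-- The map of the arrow `j → i`, for `j = i + 1`. -/
def downTo (i j : ℤ) (h : i + 1 = j) : R.V j →ₗ[k] R.V i := by
  subst h
  exact R.down i

lemma zero_mem_pureDims : 0 ∈ R.pureDims :=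
  ⟨{ W := fun _ ↦ ⊥
     up_mem := fun i w hw ↦ by
      obtain rfl := (Submodule.mem_bot k).mp hw
      simp
     down_mem := fun i w hw ↦ by
      obtain rfl := (Submodule.mem_bot k).mp hw
      simp }, fun _ ↦ ⟨inferInstance, finrank_bot _ _⟩⟩

/-- The space at the vertex `0` bounds all pure dimensions and the zero subrepresentation is pure,
so the supremum in `ℕ` is a true maximum and not the default value. -/
lemma isGreatest_pureDims [Module.Finite k (R.V 0)] : IsGreatest R.pureDims (sSup R.pureDims) := by
  have hb : BddAbove R.pureDims := ⟨Module.finrank k (R.V 0), fun r ⟨S, hS⟩ ↦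
    (hS 0).2 ▸ Submodule.finrank_le _⟩
  exact ⟨Nat.sSup_mem ⟨0, R.zero_mem_pureDims⟩ hb, fun r hr ↦ le_csSup hb hr⟩

variable {R} {R' : ZRep k}

/-- Injective maps between representations, compatible with the maps up to nonzero constants. -/
structure IsTwistedEmbedding (j : ∀ i, R'.V i →ₗ[k] R.V i) : Prop where
  injective : ∀ i, Function.Injective (j i)
  up : ∀ i, ∃ c : k, c ≠ 0 ∧ ∀ x, j (i + 1) (R'.up i x) = c • R.up i (j i x)
  down : ∀ i, ∃ c : k, c ≠ 0 ∧ ∀ x, j i (R'.down i x) = c • R.down i (j (i + 1) x)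

lemma IsTwistedEmbedding.pureDims_subset {j : ∀ i, R'.V i →ₗ[k] R.V i}
    (hj : IsTwistedEmbedding j) : R'.pureDims ⊆ R.pureDims := by
  rintro r ⟨S, hS⟩
  refine ⟨{ W := fun i ↦ (S.W i).map (j i), up_mem := ?_, down_mem := ?_ }, fun i ↦ ?_⟩
  · rintro i _ ⟨x, hx, rfl⟩
    obtain ⟨c, hc, h⟩ := hj.up i
    rw [← Submodule.smul_mem_iff _ hc, ← h]
    exact ⟨_, S.up_mem i x hx, rfl⟩
  · rintro i _ ⟨x, hx, rfl⟩
    obtain ⟨c, hc, h⟩ := hj.down i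
    rw [← Submodule.smul_mem_iff _ hc, ← h]
    exact ⟨_, S.down_mem i x hx, rfl⟩
  · let e := Submodule.equivMapOfInjective (j i) (hj.injective i) (S.W i)
    have := (hS i).1
    exact ⟨Module.Finite.equiv e, e.symm.finrank_eq.trans (hS i).2⟩

lemma IsTwistedEmbedding.mem_pureDims {j : ∀ i, R'.V i →ₗ[k] R.V i} (hj : IsTwistedEmbedding j)
    (S : R.Subrep) (hSj : ∀ i, S.W i ≤ LinearMap.range (j i)) {r : ℕ} (hS : S.IsPure r) :
    r ∈ R'.pureDims := by
  refine ⟨{ W := fun i ↦ (S.W i).comap (j i), up_mem := ?_, down_mem := ?_ }, fun i ↦ ?_⟩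
  · intro i x hx
    obtain ⟨c, hc, h⟩ := hj.up i
    rw [Submodule.mem_comap, h]
    exact Submodule.smul_mem _ _ (S.up_mem i _ hx)
  · intro i x hx
    obtain ⟨c, hc, h⟩ := hj.down i
    rw [Submodule.mem_comap, h]
    exact Submodule.smul_mem _ _ (S.down_mem i _ hx)
  · have e := Submodule.equivMapOfInjective (j i) (hj.injective i) ((S.W i).comap (j i))
    have h : ((S.W i).comap (j i)).map (j i) = S.W i := by
      rw [Submodule.map_comap_eq, inf_eq_right.mpr (hSj i)]
    rw [h] at e
    have := (hS i).1
    exact ⟨Module.Finite.equiv e.symm, e.finrank_eq.trans (hS i).2⟩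

/-- If one of the two kinds of maps only has values in the subrepresentation, and the other kind
detects membership in it, then pure dimensions drop by at most one. -/
theorem IsTwistedEmbedding.exists_mem_pureDims {j : ∀ i, R'.V i →ₗ[k] R.V i}
    (hj : IsTwistedEmbedding j)
    (hK : ∀ i (x y : R.V i), ∃ a b : k, (a ≠ 0 ∨ b ≠ 0) ∧ a • x + b • y ∈ LinearMap.range (j i))
    (h : ((∀ i x, R.down i (R.up i x) = 0) ∧
        ∀ i x, R.down i x ∈ LinearMap.range (j i) → x ∈ LinearMap.range (j (i + 1))) ∨
      ((∀ i x, R.up i (R.down i x) = 0) ∧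
        ∀ i x, R.up i x ∈ LinearMap.range (j (i + 1)) → x ∈ LinearMap.range (j i)))
    {r : ℕ} (hr : r ∈ R.pureDims) : ∃ n ∈ R'.pureDims, r ≤ n + 1 := by
  obtain ⟨S, hS⟩ := hr
  have hKu : ∀ i x, x ∈ LinearMap.range (j i) → R.up i x ∈ LinearMap.range (j (i + 1)) := by
    rintro i _ ⟨x, rfl⟩
    obtain ⟨c, hc, h⟩ := hj.up i
    rw [← Submodule.smul_mem_iff _ hc, ← h]
    exact ⟨_, rfl⟩
  have hKd : ∀ i x, x ∈ LinearMap.range (j (i + 1)) → R.down i x ∈ LinearMap.range (j i) := by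
    rintro i _ ⟨x, rfl⟩
    obtain ⟨c, hc, h⟩ := hj.down i
    rw [← Submodule.smul_mem_iff _ hc, ← h]
    exact ⟨_, rfl⟩
  obtain ⟨W, hWS, hWK, hWu, hWd, n, hn, hW⟩ : ∃ W : ∀ i, Submodule k (R.V i),
      (∀ i, W i ≤ S.W i) ∧ (∀ i, W i ≤ LinearMap.range (j i)) ∧
      (∀ i j h, ∀ x ∈ W i, R.upTo i j h x ∈ W j) ∧ (∀ i j h, ∀ x ∈ W j, R.downTo i j h x ∈ W i) ∧
      ∃ n, r ≤ n + 1 ∧ ∀ i, Module.finrank k (W i) = n := by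
    rcases h with ⟨h0, h⟩ | ⟨h0, h⟩
    · refine exists_pure_of_codim_le_one R.upTo R.downTo ?_ S.W (fun i ↦ LinearMap.range (j i)) hS
        ?_ ?_ ?_ ?_ hK <;> rintro i _ rfl
      · exact h0 i
      · exact S.up_mem i
      · exact S.down_mem i
      · exact fun x ↦ h i _ (by
          rw [show R.upTo i _ rfl x = R.up i x from rfl, h0]; exact zero_mem _)
      · exact fun x ↦ ⟨h i x, hKd i x⟩
    · refine exists_pure_of_codim_le_one' R.upTo R.downTo ?_ S.W (fun i ↦ LinearMap.range (j i)) hS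
        ?_ ?_ ?_ ?_ hK <;> rintro i _ rfl
      · exact h0 i
      · exact S.up_mem i
      · exact S.down_mem i
      · exact fun x ↦ h i _ (by
          rw [show R.downTo i _ rfl x = R.down i x from rfl, h0]; exact zero_mem _)
      · exact fun x ↦ ⟨h i x, hKu i x⟩
  refine ⟨n, hj.mem_pureDims ⟨W, fun i ↦ hWu i _ rfl, fun i ↦ hWd i _ rfl⟩ hWK fun i ↦ ?_, hn⟩
  have := (hS i).1
  exact ⟨Submodule.finiteDimensional_of_le (hWS i), hW i⟩

end ZRep

/-! ### The inclusion of `L(-P)` as a modification of codimension at most one. -/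

namespace TwoComponentCurve

variable {k : Type u} [Field k] {C : TwoComponentCurve k}

lemma TwistChain.isLink {L : C.X.Modules} (T : C.TwistChain L) (i : ℤ) :
    IsLink C.idealY C.idealZ (T.up i) (T.down i) :=
  ⟨T.isLineBundle i, T.isLineBundle (i + 1), T.kernel_up i, T.image_up i, T.kernel_down i,
    T.image_down i⟩

section

variable {P : Spec (.of k) ⟶ C.X} {LP L : C.X.Modules} {ι : LP ⟶ L}

lemma IsTwistByPoint.isModification (hP : P ≫ C.f = 𝟙 _) (hι : C.IsTwistByPoint P ι) :
    IsModification (pt P) ι := by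
  have := C.isProper
  have := isClosedImmersion_of_section hP
  have := hι.mono
  have hinj := app_injective_of_mono ι
  refine ⟨hinj, fun U hU t ↦ app_surjective_of_locally ι hinj t fun x hx ↦ ?_⟩
  obtain ⟨V, hxV, hVU⟩ := exists_affine_le hx
  refine ⟨V.1, hVU, hxV, (hι.image V _).mpr ?_⟩
  rw [idealMul, ideal_eq_top_of_disjoint_support _ V fun y hy hyP ↦ ?_]
  · simp
  · rw [← SetLike.mem_coe, Scheme.Hom.support_ker, range_eq_pt,
      (isClosed_pt hP).closure_eq] at hyP
    obtain rfl : y = pt P := hyP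
    exact hU (hVU hy)

/-- Near `P`, sections have values in `k` after trivialising `L`, and two values `x`, `y` satisfy
the relation `y * x - x * y = 0`; the corresponding combination vanishes at `P`. -/
lemma IsTwistByPoint.isCodimLEOne (hP : P ≫ C.f = 𝟙 _) (hι : C.IsTwistByPoint P ι)
    (hL : L.IsLineBundle) : IsCodimLEOne C.scalars ι := by
  have := C.isProper
  have := isClosedImmersion_of_section hP
  refine (hι.isModification hP).isCodimLEOne (isClosed_pt hP) fun U s t ↦ ?_
  by_cases hU : pt P ∈ U
  · obtain ⟨V, hV, hVU, e, he⟩ := hL.exists_generator hU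
    refine ⟨V.1, hVU, fun _ ↦ hV, ?_⟩
    obtain ⟨φ, hφ⟩ := exists_eq_specMap P V.2 hV
    obtain ⟨a, ha : a • e = _⟩ := he.bijective.2 (L.res hVU s)
    obtain ⟨b, hb : b • e = _⟩ := he.bijective.2 (L.res hVU t)
    have hφc : ∀ c, φ (C.X.fres le_top (C.scalars c)) = c := fun c ↦ apply_fres_eq hP hφ c
    have key : ∀ c d, c * φ a + d * φ b = 0 → ∃ q, ι.app V.1 q =
        C.X.fres (le_top : V.1 ≤ ⊤) (C.scalars c) • L.res hVU s +
          C.X.fres (le_top : V.1 ≤ ⊤) (C.scalars d) • L.res hVU t := by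
      intro c d h
      rw [hι.image V, ← ha, ← hb, ← mul_smul, ← mul_smul, ← add_smul, he.mem_idealMul_iff]
      exact mem_ker_of_apply_eq_zero hφ (by rw [map_add, map_mul, map_mul, hφc, hφc, h])
    by_cases h0 : φ a = 0
    · exact ⟨1, 0, by simp, key 1 0 (by simp [h0])⟩
    · exact ⟨φ b, -φ a, by simp [h0], key _ _ (by ring)⟩
  · refine ⟨U, le_rfl, fun h ↦ (hU h).elim, 1, 0, by simp, ?_⟩
    exact (hι.isModification hP).surjective U hU _

end

end TwoComponentCurve

namespace AlgebraicGeometry.Scheme.Modules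

variable {X : Scheme.{u}} {k : Type*} [Field k] {σ : k →+* Γ(X, ⊤)} {M M' Q Q' : X.Modules}

lemma app_bijective_of_isIso (φ : M ⟶ M') [IsIso φ] (U : X.Opens) :
    Function.Bijective (φ.app U) :=
  have := Hom.isIso_iff_isIso_app.mp (inferInstance : IsIso φ) U
  ConcreteCategory.bijective_of_isIso (φ.app U)

lemma comp_app_apply (φ : M ⟶ M') (ψ : M' ⟶ Q) {U : X.Opens} (s : Γ(M, U)) :
    (φ ≫ ψ).app U s = ψ.app U (φ.app U s) := rfl

lemma IsModification.conj {p : X} {ι : Q ⟶ M} (h : IsModification p ι) (α : Q' ⟶ Q) [IsIso α]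
    (β : M ⟶ M') [IsIso β] : IsModification p (α ≫ ι ≫ β) :=
  ⟨fun U ↦ (app_bijective_of_isIso β U).1.comp
    ((h.injective U).comp (app_bijective_of_isIso α U).1),
  fun U hU ↦ (app_bijective_of_isIso β U).2.comp
    ((h.surjective U hU).comp (app_bijective_of_isIso α U).2)⟩

lemma IsCodimLEOne.conj {ι : Q ⟶ M} (h : IsCodimLEOne σ ι) (α : Q' ⟶ Q) [IsIso α]
    (β : M ⟶ M') [IsIso β] : IsCodimLEOne σ (α ≫ ι ≫ β) := by
  intro U s t
  obtain ⟨s, rfl⟩ := (app_bijective_of_isIso β U).2 s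
  obtain ⟨t, rfl⟩ := (app_bijective_of_isIso β U).2 t
  obtain ⟨a, b, hab, q, hq⟩ := h U s t
  obtain ⟨q, rfl⟩ := (app_bijective_of_isIso α U).2 q
  exact ⟨a, b, hab, q, by
    rw [comp_app_apply, comp_app_apply, hq, map_add, Hom.app_smul, Hom.app_smul]⟩

end AlgebraicGeometry.Scheme.Modules

/-! ### Extension to the whole chain and conclusion. -/

namespace TwoComponentCurve

variable {k : Type u} [Field k] {C : TwoComponentCurve k}

/-- A modification at a point of the zeroth terms of two twist chains extends to the whole
chains. -/
theorem TwistChain.exists_modifications {L L' : C.X.Modules} (T : C.TwistChain L)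
    (T' : C.TwistChain L') {p : C.X} (hp : IsClosed {p})
    (hpN : p ∈ C.idealY.support → p ∉ C.idealZ.support) {ι₀ : T'.obj 0 ⟶ T.obj 0}
    (hι₀ : IsModification p ι₀) :
    ∃ ι : ∀ i, T'.obj i ⟶ T.obj i, ι 0 = ι₀ ∧ (∀ i, IsModification p (ι i)) ∧
      ∀ i, LinkCompat C.scalars (T.up i) (T.down i) (T'.up i) (T'.down i) (ι i) (ι (i + 1)) := by
  have := C.isReduced
  obtain ⟨f, hf0, hf⟩ := exists_int_family
    (P := fun i ↦ {ι : T'.obj i ⟶ T.obj i // IsModification p ι})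
    (fun i j h x y ↦ LinkCompat C.scalars (T.up i) (T.down i) (T'.up i) (T'.down i) x.1
      (Eq.rec (motive := fun j _ ↦ {ι : T'.obj j ⟶ T.obj j // IsModification p ι}) y h.symm).1)
    0 ⟨ι₀, hι₀⟩
    (fun i j h _ x ↦ by
      subst h
      obtain ⟨ι', h1, h2⟩ := x.2.exists_lift (T.isLink i) (T'.isLink i) C.isNodal hp hpN
      exact ⟨⟨ι', h1⟩, h2⟩)
    (fun i j h _ y ↦ by
      subst h
      obtain ⟨ι', h1, h2⟩ := y.2.exists_lift (T.isLink i).symm (T'.isLink i).symm C.isNodal.symm hp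
        (fun h h' ↦ hpN h' h)
      exact ⟨⟨ι', h1⟩, h2.symm⟩)
  exact ⟨fun i ↦ (f i).1, congr_arg Subtype.val hf0, fun i ↦ (f i).2, fun i ↦ hf i _ rfl⟩

lemma TwistChain.isGreatest_h0 {L : C.X.Modules} (T : C.TwistChain L) :
    IsGreatest T.rep.pureDims T.h0 := by
  have : Module.Finite k (T.rep.V 0) := C.finite_H0 (T.isLineBundle 0)
  exact T.rep.isGreatest_pureDims

end TwoComponentCurve

theorem mainTheorem12 {k : Type u} [Field k] (C : TwoComponentCurve k)
    (L : C.X.Modules) (hL : L.IsLineBundle)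
    (P : Spec (.of k) ⟶ C.X) (hP : P ≫ C.f = 𝟙 _) (hPN : P ≠ C.N)
    (LP : C.X.Modules) (ι : LP ⟶ L) (hι : C.IsTwistByPoint P ι)
    (T : C.TwistChain L) (TP : C.TwistChain LP) :
    IsGreatest T.rep.pureDims T.h0 ∧ IsGreatest TP.rep.pureDims TP.h0 ∧
      (T.h0 : ℤ) - 1 ≤ TP.h0 ∧ TP.h0 ≤ T.h0 := by
  have := C.isProper
  have hp := isClosed_pt hP
  have hpN : pt P ∈ C.idealY.support → pt P ∉ C.idealZ.support := fun h h' ↦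
    hPN (eq_of_pt_eq hP C.N_comp_f (C.eq_pt_N h h'))
  obtain ⟨j, hj0, hj, hjc⟩ := T.exists_modifications TP hp hpN
    ((hι.isModification hP).conj TP.zeroIso.hom T.zeroIso.inv)
  have hemb : ZRep.IsTwistedEmbedding (R := T.rep) (R' := TP.rep) fun i ↦ C.H0map (j i) :=
    { injective := fun i ↦ (hj i).injective ⊤
      up := fun i ↦ by
        obtain ⟨c, hc, h⟩ := (hjc i).up
        exact ⟨c, hc, fun x ↦ (h ⊤ x).trans (by rw [fres_self]; rfl)⟩
      down := fun i ↦ by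
        obtain ⟨c, hc, h⟩ := (hjc i).down
        exact ⟨c, hc, fun x ↦ (h ⊤ x).trans (by rw [fres_self]; rfl)⟩ }
  -- The component avoided by `P` decides which of the two kinds of maps is invertible near `P`, and
  -- hence which of the two mirror arguments applies.
  have hcase : pt P ∉ C.idealZ.support ∨ pt P ∉ C.idealY.support := by tauto
  have hstep : ∀ i l, i + 1 = l →
      (IsCodimLEOne C.scalars (j i) ↔ IsCodimLEOne C.scalars (j l)) := by
    rintro i _ rfl
    rcases hcase with h | h
    · exact ⟨(hjc i).isCodimLEOne (T.isLink i) (TP.isLink i) C.isNodal h hp (hj _),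
        (hjc i).isCodimLEOne_of_lift (T.isLink i) C.isNodal h hp (hj _)⟩
    · exact ⟨(hjc i).symm.isCodimLEOne_of_lift (T.isLink i).symm C.isNodal.symm h hp (hj _),
        (hjc i).symm.isCodimLEOne (T.isLink i).symm (TP.isLink i).symm C.isNodal.symm h hp (hj _)⟩
  -- The condition is known for `L(-P) → L` at index `0` and spreads in both directions along the
  -- chain.
  have hcodim : ∀ i, IsCodimLEOne C.scalars (j i) := by
    intro i
    induction i with
    | zero =>
      rw [hj0]
      exact (hι.isCodimLEOne hP hL).conj _ _
    | succ i hi => exact (hstep _ _ rfl).mp hi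
    | pred i hi => exact (hstep _ _ (sub_add_cancel _ 1)).mpr hi
  have hT := T.isGreatest_h0
  have hTP := TP.isGreatest_h0
  refine ⟨hT, hTP, ?_, hT.2 (hemb.pureDims_subset hTP.1)⟩
  obtain ⟨n, hn, hrn⟩ := hemb.exists_mem_pureDims
    (fun i x y ↦ by
      obtain ⟨a, b, hab, q, hq⟩ := hcodim i ⊤ x y
      rw [fres_self, fres_self] at hq
      exact ⟨a, b, hab, q, hq⟩) (by
      rcases hcase with h | h
      · exact .inl ⟨fun i x ↦ (T.isLink i).down_up x, fun i x hx ↦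
          (hjc i).exists_of_down (T.isLink i) (TP.isLink i) C.isNodal h hp (hj _) hx⟩
      · exact .inr ⟨fun i x ↦ (T.isLink i).symm.down_up x, fun i x hx ↦
          (hjc i).symm.exists_of_down (T.isLink i).symm (TP.isLink i).symm C.isNodal.symm h hp
            (hj _) hx⟩) hT.1
  have := hTP.2 hn
  omega
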